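/- **Problem.** Let $X$ be a nonempty set and let $L:X\times X\to[0,\infty]$ be a quasi-distance: $L(x,x)=0$ and $L(x,y)=L(y,x)$ for all $x,y$ (no triangle inequality is required). Each strategy $x\in X$ has an unknown payoff distribution $\mathcal D(x)$ on $[0,1]$ with mean $\mu(x)$. Let $\mu^*=\sup_{x}\mu(x)$ and $\Delta(x)=\mu^*-\mu(x)$. Instead of the Lipschitz condition, assume only that $$(\forall \varepsilon>0)\ (\exists v^*\in X)\ (\forall u\in X)\quad \Delta(u)\le L(u,v^*)+\varepsilon .$$ (This holds in particular if $\Delta(u)\le L(u,v^*)$ for all $u$ and some $v^*\in\arg\max\mu$.) In each round an algorithm plays a strategy $x$ and observes an independent sample from $\mathcal D(x)$. It has access to $(L,X)$ only through a covering oracle, which, given finitely many open balls $B(v,r)=\{u: L(v,u)<r\}$, either declares that they cover $X$ or outputs an uncovered point. Its regret after $t$ rounds is $R(t)=t\mu^*-\mathbb E[\text{total payoff in the first } t \text{ rounds}]$. For $C>0$, the $C$-zooming dimension is the smallest $d\in\mathbb R$ such that for every $r\in(0,1]$ the set $\{x: r/2<\Delta(x)\le r\}$ can be covered by at most $C r^{-d}$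 sets of $L$-diameter at most $r/8$. **Zooming algorithm.** The algorithm runs in phases; phase $i$ lasts $\ell_i\ge 2$ rounds. Let $n_t(v)$ and $\mu_t(v)$ be the number of plays and the average reward of $v$ so far in the current phase ($\mu_t(v)=0$ if $n_t(v)=0$). The confidence radius $r_t(v)$ is a function of $i$, $n_t(v)$ and $\mu_t(v)$ satisfying $$\rho_t(v)\le r_t(v)\le 2\rho_t(v),\qquad \rho_t(v)=\frac{\alpha_i}{1+n_t(v)}+\sqrt{\alpha_i\,\frac{1-\mu_t(v)}{1+n_t(v)}},\qquad \alpha_i=\kappa\log \ell_i ,$$ whenever $\mu_t(v)\in[0,1]$. At the start of each phase no strategy is active. In each round the algorithm asks the oracle once about the balls $B(v,r_t(v))$ of the active strategies $v$; if an uncovered strategy is returned, it becomes active. Then an active strategy with maximal index $\mu_t(v)+2r_t(v)$ is played, with ties broken arbitrarily. **Theorem.** One can choose the phase lengths $\ell_i$, the function defining the confidence radius, and constants $\kappa,K>0$, all of them absolute (independent of $X$, $L$, $\mathcal D$, $C$, $d$, the oracle and the tie-breaking rule), so that for all $X$, all quasi-distances $L$, all covering oracles and all tie-breaking rules, the zooming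 algorithm is a well-defined measurable decision rule, and for all $\mathcal D$ satisfying the relaxed Lipschitz condition the following holds with $\beta=2$, and also with $\beta=1$ if $\mu^*=1$. For every $C>0$, every $d\in\mathbb R$ with the covering property above (in particular for the $C$-zooming dimension $d$), and every integer $t\ge 2$: (a) if $d+\beta>1$, then $R(t)\le (K\,C\log^2 t)^{1/(d+\beta)}\; t^{\,1-1/(d+\beta)}$; (b) if $d+\beta\le 1$, then $R(t)\le K\,C\log^2 t$. -/

import Mathlib

open MeasureTheory
open scoped ENNReal

noncomputable section

namespace ZoomingBandit

universe u

/-! ### The problem: similarity functions and payoff distributions -/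

/-- A quasi-distance with values in `[0, ∞]`: symmetric and zero on the diagonal.  No triangle
inequality is required, and no bound on the diameter. -/
structure IsQuasiDistance {X : Type u} (L : X → X → ℝ≥0∞) : Prop where
  self_eq_zero : ∀ x, L x x = 0
  symm : ∀ x y, L x y = L y x

/-- The expected payoff `μ(x)` of the strategy `x`, whose payoff distribution is `D x`. -/
def mean {X : Type u} (D : X → Measure ℝ) (x : X) : ℝ := ∫ y, y ∂(D x)

/-- The maximal expected reward `μ* = sup_x μ(x)`. -/
def bestMean {X : Type u} (D : X → Measure ℝ) : ℝ := ⨆ x, mean D x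

/-- The badness `Δ(x) = μ* - μ(x)`. -/
def gap {X : Type u} (D : X → Measure ℝ) (x : X) : ℝ := bestMean D - mean D x

/-- The relaxed Lipschitz condition: for every `ε > 0` there is a strategy `v` such that
`Δ(u) ≤ L(u, v) + ε` for all `u`.  (If `Δ(u) ≤ L(u, v)` for all `u` and one optimal `v`, this
holds with that same `v` for every `ε`.) -/
def RelaxedLipschitz {X : Type u} (L : X → X → ℝ≥0∞) (D : X → Measure ℝ) : Prop :=
  ∀ ε : ℝ, 0 < ε → ∃ v : X, ∀ u : X, ENNReal.ofReal (gap D u) ≤ L u v + ENNReal.ofReal ε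

/-- The covering property defining the zooming dimension: for every `r ∈ (0, 1]` the set
`{x | r / 2 < Δ(x) ≤ r}` can be covered by at most `C r ^ (-d)` sets of diameter at most `r / 8`.
The `C`-zooming dimension is the smallest `d` with this property. -/
def ZoomingCover {X : Type u} (L : X → X → ℝ≥0∞) (D : X → Measure ℝ) (C d : ℝ) : Prop :=
  ∀ r : ℝ, 0 < r → r ≤ 1 → ∃ (N : ℕ) (F : Fin N → Set X),
    (N : ℝ) ≤ C * r ^ (-d) ∧
    (∀ x, r / 2 < gap D x → gap D x ≤ r → ∃ i, x ∈ F i) ∧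
    ∀ i, ∀ x ∈ F i, ∀ y ∈ F i, L x y ≤ ENNReal.ofReal (r / 8)

/-! ### The covering oracle and the zooming algorithm -/

/-- `O` is a covering oracle for `L`: given a finite list of open balls (centre, radius), it either
answers `none`, and then they cover `X`, or it outputs a point that none of them contains. -/
def IsCoveringOracle {X : Type u} (L : X → X → ℝ≥0∞) (O : List (X × ℝ) → Option X) : Prop :=
  ∀ balls : List (X × ℝ),
    (O balls = none → ∀ x, ∃ b ∈ balls, L b.1 x < ENNReal.ofReal b.2) ∧
    (∀ x, O balls = some x → ∀ b ∈ balls, ¬ L b.1 x < ENNReal.ofReal b.2)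

/-- A rule that selects a member of every nonempty list; it is used to break ties. -/
def IsTieBreaking {X : Type u} (tie : List X → X) : Prop := ∀ l : List X, l ≠ [] → tie l ∈ l

/-- What the algorithm remembers: the number of the current phase, the number of rounds already
spent in it, the strategies activated in it, and all past observations (most recent first). -/
structure State (X : Type u) where
  phase : ℕ
  age : ℕ
  active : List X
  history : List (X × ℝ)

/-- At the start nothing has been played and no strategy is active. -/
def State.init (X : Type u) : State X := ⟨0, 0, [], []⟩

open Classical in
/-- The rewards that `v` has received in the current phase. -/
def State.rewards {X : Type u} (st : State X) (v : X) : List ℝ :=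
  ((st.history.take st.age).filter (fun p => p.1 = v)).map Prod.snd

/-- `n_t(v)`: the number of times `v` has been played in the current phase. -/
def State.count {X : Type u} (st : State X) (v : X) : ℕ := (st.rewards v).length

/-- `μ_t(v)`: the average reward of `v` in the current phase (zero if `v` was not played). -/
def State.avg {X : Type u} (st : State X) (v : X) : ℝ := (st.rewards v).sum / (st.count v : ℝ)

/-- The confidence radius `r_t(v)`, as a function `rad` of the phase, of the number of plays of `v`
in the phase and of their average reward. -/
def State.radius {X : Type u} (rad : ℕ → ℕ → ℝ → ℝ) (st : State X) (v : X) : ℝ :=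
  rad st.phase (st.count v) (st.avg v)

/-- The index `I_t(v) = μ_t(v) + 2 r_t(v)`. -/
def State.index {X : Type u} (rad : ℕ → ℕ → ℝ → ℝ) (st : State X) (v : X) : ℝ :=
  st.avg v + 2 * st.radius rad v

/-- First step of a round: one query to the covering oracle about the balls `B(v, r_t(v))` of the
active strategies; if an uncovered strategy is returned, it becomes active. -/
def State.activated {X : Type u} (rad : ℕ → ℕ → ℝ → ℝ) (O : List (X × ℝ) → Option X)
    (st : State X) : List X :=
  st.active ++ (O (st.active.map fun v => (v, st.radius rad v))).toList

open Classical in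
/-- Second step of a round: play an active strategy with maximal index. -/
def State.play {X : Type u} (rad : ℕ → ℕ → ℝ → ℝ) (O : List (X × ℝ) → Option X)
    (tie : List X → X) (st : State X) : X :=
  tie ((st.activated rad O).filter fun v =>
    ∀ u ∈ st.activated rad O, st.index rad u ≤ st.index rad v)

/-- The state after a round in which the reward `y` was observed.  Phase `i` lasts `len i` rounds;
at its end all strategies are deactivated and the next phase begins. -/
def State.next {X : Type u} (len : ℕ → ℕ) (rad : ℕ → ℕ → ℝ → ℝ) (O : List (X × ℝ) → Option X)
    (tie : List X → X) (st : State X) (y : ℝ) : State X :=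
  if st.age + 1 < len st.phase then
    ⟨st.phase, st.age + 1, st.activated rad O, (st.play rad O tie, y) :: st.history⟩
  else
    ⟨st.phase + 1, 0, [], (st.play rad O tie, y) :: st.history⟩

open Classical in
/-- The reward received in state `st` when `x` is played: `ω (x, k)` is the reward from the
trial of `x` that is preceded by exactly `k` trials of `x`, counted over all phases. -/
def State.reward {X : Type u} (st : State X) (x : X) (ω : X × ℕ → ℝ) : ℝ :=
  ω (x, st.history.countP fun p => p.1 = x)

/-- The state of the zooming algorithm after `t` rounds on the table of rewards `ω`. -/
def run {X : Type u} (len : ℕ → ℕ) (rad : ℕ → ℕ → ℝ → ℝ) (O : List (X × ℝ) → Option X)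
    (tie : List X → X) (ω : X × ℕ → ℝ) : ℕ → State X
  | 0 => State.init X
  | t + 1 =>
    let st := run len rad O tie ω t
    st.next len rad O tie (st.reward (st.play rad O tie) ω)

/-- The strategy played by the zooming algorithm in round `t` (rounds are numbered from `0`). -/
def played {X : Type u} (len : ℕ → ℕ) (rad : ℕ → ℕ → ℝ → ℝ) (O : List (X × ℝ) → Option X)
    (tie : List X → X) (t : ℕ) (ω : X × ℕ → ℝ) : X :=
  (run len rad O tie ω t).play rad O tie

/-- The reward that the zooming algorithm receives in round `t`. -/
def payoff {X : Type u} (len : ℕ → ℕ) (rad : ℕ → ℕ → ℝ → ℝ) (O : List (X × ℝ) → Option X)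
    (tie : List X → X) (t : ℕ) (ω : X × ℕ → ℝ) : ℝ :=
  (run len rad O tie ω t).reward (played len rad O tie t ω) ω

/-- The algorithm is a legitimate (measurable) decision rule: the strategy played in each round is a
measurable function of the rewards that takes countably many values. -/
def WellPosed {X : Type u} (len : ℕ → ℕ) (rad : ℕ → ℕ → ℝ → ℝ) (O : List (X × ℝ) → Option X)
    (tie : List X → X) : Prop :=
  ∀ t, (Set.range (played len rad O tie t)).Countable ∧
    ∀ x, MeasurableSet {ω : X × ℕ → ℝ | played len rad O tie t ω = x}

/-- The confidence radius `α / (1 + n) + √(α (1 - m) / (1 + n))` after `n` plays with average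
reward `m`. -/
def refinedRadius (α : ℝ) (n : ℕ) (m : ℝ) : ℝ :=
  α / (1 + n) + √(α * (1 - m) / (1 + n))

/-! ### Regret -/

/-- The law of the table of rewards: all trials are independent, every trial of `x` has the
payoff distribution `D x`. -/
def rewardLaw {X : Type u} (D : X → Measure ℝ) [∀ x, IsProbabilityMeasure (D x)] :
    Measure (X × ℕ → ℝ) :=
  Measure.infinitePi fun p : X × ℕ => D p.1

/-- The regret after `t` rounds: `t μ*` minus the expected total payoff. -/
def regret {X : Type u} (D : X → Measure ℝ) [∀ x, IsProbabilityMeasure (D x)] (len : ℕ → ℕ)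
    (rad : ℕ → ℕ → ℝ → ℝ) (O : List (X × ℝ) → Option X) (tie : List X → X) (t : ℕ) : ℝ :=
  t * bestMean D - ∫ ω, (∑ s ∈ Finset.range t, payoff len rad O tie s ω) ∂(rewardLaw D)

/-- The `β`-good regret guarantee with the constant `K` for a regret function `R`.  It is required
for every `d` with the covering property, in particular for the `C`-zooming dimension. -/
def GoodRegret {X : Type u} (K β : ℝ) (L : X → X → ℝ≥0∞) (D : X → Measure ℝ) (R : ℕ → ℝ) : Prop :=
  ∀ C d : ℝ, 0 < C → ZoomingCover L D C d → ∀ t : ℕ, 2 ≤ t →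
    (1 < d + β → R t ≤ (K * C * Real.log t ^ 2) ^ (1 / (d + β)) * (t : ℝ) ^ (1 - 1 / (d + β))) ∧
    (d + β ≤ 1 → R t ≤ K * C * Real.log t ^ 2)

end ZoomingBandit

end

namespace ZoomingBandit

/-! The regret is the expected sum of the badness `gap` of the played strategies. Put `p = d + β`.
If `p ≥ 1`, it suffices to bound the expected sum of `gap ^ p` by `K C log² t`, because Hölder's
inequality (`sum_integral_le_rpow`) turns this moment into the stated rate. If `p < 1`, enlarging
`d` until `p = 1` is harmless (`ZoomingCover.mono`).

Consider a phase in which all averages stay within their confidence radii. A fresh strategy has a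
larger index than any played one, so a strategy is replayed only when the oracle reports a cover.
Then a nearly optimal `v` lies in the ball of an active `u`, the relaxed Lipschitz condition gives
`gap u ≤ r(u) + ε`, and the index of `u` is at least `μ* - ε`. Since the played `w` has maximal
index, `gap w ≤ 3 r(w)` (`gap_played_le`). One play shrinks a radius only slightly, hence `gap ≤ 4
r` for all strategies at all times (`gap_le_radius`), and a strategy activated outside the existing
balls is at distance at least a quarter of the smaller badness from every active one
(`pairwise_activated`). No triangle inequality enters.

Therefore a set of diameter at most `r / 8` contains at most one played strategy with badness in `(r
/ 2, r]`, and `gap ≤ 3 r` at its last play limits its plays to `O(α / gap ^ β)`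
(`count_add_one_mul_rpow_le`). The exponent `β = 1` is available for `μ* = 1`, because the
square-root term of the radius is then controlled by the badness itself. With `C r ^ (-d)` covering
sets the powers of `r` cancel in the `p`-th moment: each dyadic scale costs `O(α C)`
(`sum_scale_le`), and logarithmically many scales matter (`sum_gap_rpow_le`).

A union bound over `X` is impossible. Instead it runs over the age at which a strategy is activated
and over its number of plays; the later trials of that strategy are independent of its activation
(`lintegral_adaptive`), and a Chernoff bound applies (`measure_deviation_le`). A phase of length `ℓ`
is bad with probability at most `1 / ℓ`, and then each round costs at most `(sup gap) ^ p ≤ C`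
(`rpow_le_of_zoomingCover`), so the bound stays proportional to `C`.

The phase lengths `2 ^ 2 ^ i` make the cost of phase `i` of order `C 4 ^ i`, a geometric series
dominated by its last term. The oracle and the tie-breaking rule are arbitrary functions;
measurability is restored by rounding the radius up to a grid, so that the oracle's queries take
only countably many values. -/

/-! ### The confidence radius -/

/-- The refined confidence radius, rounded up to the grid of mesh `α / (100 (1 + n))`. -/
noncomputable def gridRadius (α : ℝ) (n : ℕ) (m : ℝ) : ℝ :=
  α / (100 * (1 + n)) * (⌈100 * (1 + n) / α * refinedRadius α n m⌉₊ : ℝ)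

lemma div_le_refinedRadius (α : ℝ) (n : ℕ) (m : ℝ) : α / (1 + n) ≤ refinedRadius α n m :=
  le_add_of_nonneg_right (Real.sqrt_nonneg _)

lemma refinedRadius_pos {α : ℝ} (hα : 0 < α) (n : ℕ) (m : ℝ) : 0 < refinedRadius α n m :=
  lt_of_lt_of_le (by positivity) (div_le_refinedRadius α n m)

lemma refinedRadius_le_gridRadius {α : ℝ} (hα : 0 < α) (n : ℕ) (m : ℝ) :
    refinedRadius α n m ≤ gridRadius α n m := by
  have h := Nat.le_ceil (100 * (1 + n) / α * refinedRadius α n m)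
  have h2 := mul_le_mul_of_nonneg_left h (show 0 ≤ α / (100 * (1 + (n : ℝ))) by positivity)
  refine le_trans (le_of_eq ?_) h2
  field_simp

/-- The mesh is a hundredth of `α / (1 + n)`, which is itself a summand of the radius, so rounding
up costs at most one percent. -/
lemma gridRadius_le {α : ℝ} (hα : 0 < α) (n : ℕ) (m : ℝ) :
    gridRadius α n m ≤ 1.01 * refinedRadius α n m := by
  have h0 := refinedRadius_pos hα n m
  have h := (Nat.ceil_lt_add_one
    (show 0 ≤ 100 * (1 + n) / α * refinedRadius α n m by positivity)).le
  have h2 := mul_le_mul_of_nonneg_left h (show 0 ≤ α / (100 * (1 + (n : ℝ))) by positivity)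
  have h3 := div_le_refinedRadius α n m
  refine le_trans h2 ?_
  have : α / (100 * (1 + (n : ℝ))) * (100 * (1 + n) / α * refinedRadius α n m + 1)
      = refinedRadius α n m + 0.01 * (α / (1 + n)) := by
    field_simp
    ring
  rw [this]
  linarith

lemma gridRadius_pos {α : ℝ} (hα : 0 < α) (n : ℕ) (m : ℝ) : 0 < gridRadius α n m :=
  (refinedRadius_pos hα n m).trans_le (refinedRadius_le_gridRadius hα n m)

lemma div_le_gridRadius {α : ℝ} (hα : 0 < α) (n : ℕ) (m : ℝ) : α / (1 + n) ≤ gridRadius α n m :=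
  (div_le_refinedRadius α n m).trans (refinedRadius_le_gridRadius hα n m)

lemma one_le_gridRadius_zero {α : ℝ} (hα : 40 ≤ α) (m : ℝ) : 1 ≤ gridRadius α 0 m := by
  have := div_le_gridRadius (show 0 < α by linarith) 0 m
  norm_num at this
  linarith

/-- A strategy that was played has a smaller index than a fresh one. -/
lemma index_lt_index_fresh {α : ℝ} (hα : 40 ≤ α) {n : ℕ} (hn : n ≠ 0) {m : ℝ} (h0 : 0 ≤ m)
    (h1 : m ≤ 1) : m + 2 * gridRadius α n m < 2 * gridRadius α 0 0 := by
  have hα0 : 0 < α := by linarith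
  have hn' : (1 : ℝ) ≤ n := by exact_mod_cast Nat.one_le_iff_ne_zero.mpr hn
  have hA := gridRadius_le hα0 n m
  have hB := refinedRadius_le_gridRadius hα0 0 0
  have e1 : refinedRadius α 0 0 = α + √α := by simp [refinedRadius]
  have e2 : refinedRadius α n m ≤ α / 2 + √α := by
    unfold refinedRadius
    gcongr
    · linarith
    · rw [div_le_iff₀ (by positivity)]
      nlinarith
  have h3 : √α ≤ α / 6 := by
    rw [Real.sqrt_le_left (by positivity)]
    nlinarith
  have h4 := Real.sqrt_nonneg α
  linarith

/-- One more play of a strategy does not shrink its confidence radius by more than a quarter,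
unless the radius stays larger than every possible badness. -/
lemma gap_le_gridRadius_succ {α : ℝ} (hα : 40 ≤ α) {n : ℕ} {m m' y δ : ℝ}
    (hm : m ≤ 1) (hy : y ≤ 1) (hm' : m' * (n + 1 : ℕ) = n * m + y)
    (hδ : δ ≤ 1) (h : δ ≤ 3 * gridRadius α n m) : δ ≤ 4 * gridRadius α (n + 1) m' := by
  have hα0 : 0 < α := by linarith
  by_cases hn : n ≤ 20
  -- For few plays the first summand alone is at least `40 / 22`, above every possible badness.
  · have h1 := div_le_gridRadius hα0 (n + 1) m'
    have hn' : (n : ℝ) ≤ 20 := by exact_mod_cast hn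
    have h2 : (1 : ℝ) ≤ α / (1 + (n + 1 : ℕ)) := by
      rw [le_div_iff₀ (by positivity)]
      push_cast
      linarith
    linarith
  · have hn' : (20 : ℝ) ≤ n := by exact_mod_cast (not_le.mp hn).le
    push_cast at hm'
    -- The factor is good enough because `3 · 1.01 · 11 / 10 < 4`.
    have key : refinedRadius α n m * (10 / 11) ≤ refinedRadius α (n + 1) m' := by
      unfold refinedRadius
      rw [add_mul]
      push_cast
      gcongr
      · rw [div_mul_eq_mul_div, div_le_div_iff₀ (by positivity) (by positivity)]
        nlinarith
      · have : √(α * (1 - m) / (1 + n)) * (10 / 11)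
            = √(α * (1 - m) / (1 + n) * (10 / 11) ^ 2) := by
          rw [Real.sqrt_mul' _ (by positivity), Real.sqrt_sq (by norm_num)]
        rw [this]
        apply Real.sqrt_le_sqrt
        rw [div_mul_eq_mul_div, div_le_div_iff₀ (by positivity) (by positivity)]
        -- The accumulated loss `n (1 - m)` cannot decrease when one more reward, at most `1`, is
        -- observed.
        have h5 : (n : ℝ) * (1 - m) ≤ (n + 1) * (1 - m') := by nlinarith
        have h6 : (1 - m) * (10 / 11) ^ 2 * (1 + (n + 1)) ≤ n * (1 - m) := by
          have : (10 / 11 : ℝ) ^ 2 * (1 + (n + 1)) ≤ n := by linarith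
          nlinarith [sub_nonneg.mpr hm]
        have : (1 - m) * (10 / 11) ^ 2 * (1 + (n + 1)) ≤ (1 - m') * (1 + n) := by linarith
        nlinarith
    have h1 := gridRadius_le hα0 n m
    have h2 := refinedRadius_le_gridRadius hα0 (n + 1) m'
    have h3 := refinedRadius_pos hα0 n m
    linarith

/-- With `q = α / (1 + n)` the radius is at most `1.01 (q + √q)`. For `q ≥ 1` the claim follows from
`δ ≤ 1`; otherwise `√q` dominates and `6.06² < 40`. This is the case `β = 2`. -/
lemma mul_sq_le_of_le_gridRadius {α : ℝ} (hα : 0 < α) {n : ℕ} {m δ : ℝ} (hm0 : 0 ≤ m)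
    (hδ0 : 0 ≤ δ) (hδ : δ ≤ 1) (h : δ ≤ 3 * gridRadius α n m) : (1 + n) * δ ^ 2 ≤ 40 * α := by
  have h1 := gridRadius_le hα n m
  set q := α / (1 + (n : ℝ)) with hq
  have hn : (0 : ℝ) < 1 + n := by positivity
  have hq0 : 0 < q := by positivity
  have hqn : q * (1 + n) = α := by rw [hq]; field_simp
  have h2 : refinedRadius α n m ≤ q + √q := by
    unfold refinedRadius
    gcongr
    rw [hq]
    gcongr
    nlinarith
  have h3 : δ ^ 2 ≤ 40 * q := by
    by_cases hq1 : 1 ≤ q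
    · nlinarith
    · push Not at hq1
      have h4 : q ≤ √q := by
        rw [Real.le_sqrt' hq0]
        nlinarith
      have h5 : δ ≤ 6.06 * √q := by linarith
      have h6 := Real.sq_sqrt hq0.le
      have h7 := Real.sqrt_nonneg q
      nlinarith
  nlinarith

/-- A self-bounding argument for `β = 1`: the two hypotheses give `1 - m ≤ 4.04 ρ`, so `ρ ≤ q +
√(4.04 q ρ)`, and AM-GM absorbs `ρ / 2` on the left. Thus `ρ`, and with it `δ`, is linear in `q`. -/
lemma mul_le_of_le_gridRadius {α : ℝ} (hα : 0 < α) {n : ℕ} {m δ : ℝ}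
    (h : δ ≤ 3 * gridRadius α n m) (hclean : 1 - δ - m ≤ gridRadius α n m) :
    (1 + n) * δ ≤ 40 * α := by
  have h1 := gridRadius_le hα n m
  set q := α / (1 + (n : ℝ)) with hq
  have hn : (0 : ℝ) < 1 + n := by positivity
  have hq0 : 0 < q := by positivity
  have hqn : q * (1 + n) = α := by rw [hq]; field_simp
  set ρ := refinedRadius α n m with hρ
  have hρ0 : 0 < ρ := refinedRadius_pos hα n m
  have h2 : ρ ≤ q + √(q * (4.04 * ρ)) := by
    have e : ρ = q + √(q * (1 - m)) := by rw [hρ, refinedRadius, hq, mul_div_right_comm]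
    refine e.le.trans ?_
    gcongr
    linarith
  have h3 : √(q * (4.04 * ρ)) ≤ (4.04 * q + ρ) / 2 := by
    rw [Real.sqrt_le_left (by positivity)]
    nlinarith [sq_nonneg (4.04 * q - ρ)]
  have h4 : δ ≤ 40 * q := by linarith
  nlinarith

lemma measurable_refinedRadius (α : ℝ) (n : ℕ) : Measurable (refinedRadius α n) := by
  unfold refinedRadius
  fun_prop

/-! ### Measurable maps into discrete spaces -/

/-- A map with countable range and measurable fibres. -/
def DiscreteMeasurable {Ω β : Type*} [MeasurableSpace Ω] (f : Ω → β) : Prop :=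
  (Set.range f).Countable ∧ ∀ b, MeasurableSet {ω | f ω = b}

namespace DiscreteMeasurable

variable {Ω β γ : Type*} [MeasurableSpace Ω]

lemma const (b : β) : DiscreteMeasurable (fun _ : Ω => b) :=
  ⟨(Set.countable_singleton b).mono (by rintro _ ⟨_, rfl⟩; rfl), fun _ => MeasurableSet.const _⟩

lemma measurableSet {f : Ω → β} (hf : DiscreteMeasurable f) (S : Set β) :
    MeasurableSet {ω | f ω ∈ S} := by
  have : {ω | f ω ∈ S} = ⋃ b ∈ Set.range f ∩ S, {ω | f ω = b} := by
    ext ω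
    simp
  rw [this]
  exact MeasurableSet.biUnion (hf.1.mono Set.inter_subset_left) fun b _ => hf.2 b

lemma measurableSet_bind {f : Ω → β} (hf : DiscreteMeasurable f) {A : β → Set Ω}
    (hA : ∀ b, MeasurableSet (A b)) : MeasurableSet {ω | ω ∈ A (f ω)} := by
  have : {ω | ω ∈ A (f ω)} = ⋃ b ∈ Set.range f, {ω | f ω = b} ∩ A b := by
    ext ω
    simp only [Set.mem_ofPred_eq, Set.mem_iUnion, Set.mem_inter_iff, exists_prop]
    exact ⟨fun h => ⟨f ω, ⟨ω, rfl⟩, rfl, h⟩, fun ⟨_, _, h, h'⟩ => h ▸ h'⟩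
  rw [this]
  exact MeasurableSet.biUnion hf.1 fun b _ => (hf.2 b).inter (hA b)

/-- Choosing a second discrete observation in dependence on a first one. -/
lemma bind {f : Ω → β} (hf : DiscreteMeasurable f) {g : β → Ω → γ}
    (hg : ∀ b, DiscreteMeasurable (g b)) : DiscreteMeasurable (fun ω => g (f ω) ω) := by
  refine ⟨(hf.1.biUnion fun b _ => (hg b).1).mono ?_, fun c => ?_⟩
  · rintro _ ⟨ω, rfl⟩
    exact Set.mem_biUnion ⟨ω, rfl⟩ ⟨ω, rfl⟩
  · exact hf.measurableSet_bind (A := fun b => {ω | g b ω = c}) fun b => (hg b).2 c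

lemma comp {f : Ω → β} (hf : DiscreteMeasurable f) (h : β → γ) :
    DiscreteMeasurable (fun ω => h (f ω)) :=
  hf.bind (g := fun b _ => h b) fun b => const (h b)

lemma comp_measurable {δ : Type*} [MeasurableSpace δ] {f : Ω → β} (hf : DiscreteMeasurable f)
    {h : δ → Ω} (hh : Measurable h) : DiscreteMeasurable (fun x => f (h x)) :=
  ⟨hf.1.mono (by rintro _ ⟨x, rfl⟩; exact ⟨h x, rfl⟩), fun b => hh (hf.2 b)⟩

lemma of_measurable [Countable β] [MeasurableSpace β] [MeasurableSingletonClass β] {f : Ω → β}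
    (hf : Measurable f) : DiscreteMeasurable f :=
  ⟨Set.to_countable _, fun b => hf (measurableSet_singleton b)⟩

lemma of_measurableSet {p : Ω → Prop} (hp : MeasurableSet {ω | p ω}) :
    DiscreteMeasurable p := by
  refine ⟨Set.to_countable _, fun b => ?_⟩
  by_cases hb : b
  · simpa [hb] using hp
  · simp only [hb, eq_iff_iff, iff_false]
    exact hp.compl

lemma map_list {g : β → Ω → γ} (hg : ∀ b, DiscreteMeasurable (g b)) (l : List β) :
    DiscreteMeasurable (fun ω => l.map fun b => g b ω) := by
  induction l with
  | nil => exact const _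
  | cons b l ih =>
    simp only [List.map_cons]
    exact (hg b).bind (g := fun c ω => c :: l.map fun b => g b ω) fun c => ih.comp (c :: ·)

lemma filter_list {p : β → Ω → Prop} [∀ b ω, Decidable (p b ω)]
    (hp : ∀ b, MeasurableSet {ω | p b ω}) (l : List β) :
    DiscreteMeasurable (fun ω => l.filter fun b => p b ω) := by
  classical
  induction l with
  | nil => exact const _
  | cons b l ih =>
    simp only [List.filter_cons]
    convert (of_measurableSet (hp b)).bind
      (g := fun c ω => if decide c = true then b :: l.filter fun b => p b ω
        else l.filter fun b => p b ω) (fun c => ?_)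
    split_ifs
    · exact ih.comp (b :: ·)
    · exact ih

lemma measurable_real {f : Ω → β} (hf : DiscreteMeasurable f) (h : β → ℝ) :
    Measurable (fun ω => h (f ω)) :=
  fun S _ => hf.measurableSet (h ⁻¹' S)

end DiscreteMeasurable

/-! ### Resampling coordinates of an infinite product -/

open Classical in
/-- Replace the coordinates of `ω.1` in `S` by those of `ω.2`. -/
noncomputable def merge {ι : Type*} {E : Type*} (S : Set ι) (ω : (ι → E) × (ι → E)) : ι → E :=
  fun p => if p ∈ S then ω.2 p else ω.1 p

lemma measurable_merge {ι E : Type*} [MeasurableSpace E] (S : Set ι) :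
    Measurable (merge (E := E) S) := by
  refine measurable_pi_lambda _ fun p => ?_
  unfold merge
  split_ifs
  · exact (measurable_pi_apply p).comp measurable_snd
  · exact (measurable_pi_apply p).comp measurable_fst

/-- Replacing some coordinates by independent copies does not change the law. -/
lemma map_merge_infinitePi {ι E : Type*} [MeasurableSpace E] (μ : ι → Measure E)
    [∀ i, IsProbabilityMeasure (μ i)] (S : Set ι) :
    ((Measure.infinitePi μ).prod (Measure.infinitePi μ)).map (merge S)
      = Measure.infinitePi μ := by
  classical
  refine Measure.eq_infinitePi _ fun s t ht => ?_
  rw [Measure.map_apply (measurable_merge S) (MeasurableSet.pi s.countable_toSet fun i _ => ht i)]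
  have : merge S ⁻¹' (s : Set ι).pi t
      = ((s.filter (· ∉ S) : Finset ι) : Set ι).pi t ×ˢ
        ((s.filter (· ∈ S) : Finset ι) : Set ι).pi t := by
    ext ω
    simp only [Set.mem_preimage, Set.mem_pi, Set.mem_prod, Finset.mem_coe, Finset.mem_filter, merge]
    constructor
    · intro h
      exact ⟨fun i hi => by simpa [hi.2] using h i hi.1, fun i hi => by simpa [hi.2] using h i hi.1⟩
    · rintro ⟨h1, h2⟩ i hi
      by_cases hS : i ∈ S
      · simpa [hS] using h2 i ⟨hi, hS⟩
      · simpa [hS] using h1 i ⟨hi, hS⟩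
  rw [this, Measure.prod_prod, Measure.infinitePi_pi _ (fun i _ => ht i),
    Measure.infinitePi_pi _ (fun i _ => ht i), mul_comm]
  exact Finset.prod_filter_mul_prod_filter_not s _ _

/-- An event that does not depend on the coordinates in `S` is independent of an observable that
depends on them only. -/
lemma lintegral_indicator_infinitePi {ι E : Type*} [MeasurableSpace E] (μ : ι → Measure E)
    [∀ i, IsProbabilityMeasure (μ i)] (S : Set ι) {A : Set (ι → E)} (hA : MeasurableSet A)
    (hAS : ∀ ω ω' : ι → E, (∀ p ∉ S, ω p = ω' p) → ω ∈ A → ω' ∈ A) {f : (ι → E) → ℝ≥0∞}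
    (hf : Measurable f) (hfS : ∀ ω ω' : ι → E, (∀ p ∈ S, ω p = ω' p) → f ω = f ω') :
    ∫⁻ ω, A.indicator f ω ∂(Measure.infinitePi μ)
      = Measure.infinitePi μ A * ∫⁻ ω, f ω ∂(Measure.infinitePi μ) := by
  set P := Measure.infinitePi μ
  have hmA : ∀ ω ω' : ι → E, merge S (ω, ω') ∈ A ↔ ω ∈ A := fun ω ω' =>
    ⟨hAS _ _ fun p hp => by simp [merge, hp], hAS _ _ fun p hp => by simp [merge, hp]⟩
  have hmf : ∀ ω ω' : ι → E, f (merge S (ω, ω')) = f ω' := fun ω ω' =>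
    hfS _ _ fun p hp => by simp [merge, hp]
  calc ∫⁻ ω, A.indicator f ω ∂P
      = ∫⁻ ω, A.indicator f ω ∂((P.prod P).map (merge S)) := by rw [map_merge_infinitePi]
    _ = ∫⁻ z, A.indicator f (merge S z) ∂(P.prod P) :=
        lintegral_map (hf.indicator hA) (measurable_merge S)
    _ = ∫⁻ z, A.indicator 1 z.1 * f z.2 ∂(P.prod P) := by
        refine lintegral_congr fun z => ?_
        obtain ⟨ω, ω'⟩ := z
        by_cases h : ω ∈ A
        · simp [Set.indicator, hmA, hmf, h]
        · simp [Set.indicator, hmA, h]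
    _ = (∫⁻ ω, A.indicator 1 ω ∂P) * ∫⁻ ω, f ω ∂P :=
        lintegral_prod_mul (measurable_one.indicator hA).aemeasurable hf.aemeasurable
    _ = P A * ∫⁻ ω, f ω ∂P := by rw [lintegral_indicator_one hA]

/-! ### Measurability of the algorithm -/

open Classical in
/-- The history of observations on the table of rewards `ω` when the strategies in the list were
played (most recent first). -/
noncomputable def observations {X : Type*} (ω : X × ℕ → ℝ) : List X → List (X × ℝ)
  | [] => []
  | x :: l => (x, ω (x, l.countP fun y => y = x)) :: observations ω l

lemma map_fst_observations {X : Type*} (ω : X × ℕ → ℝ) (l : List X) :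
    (observations ω l).map Prod.fst = l := by
  induction l with
  | nil => rfl
  | cons x l ih => simp [observations, ih]

/-- The part of the state of the algorithm that does not involve rewards. -/
def State.skeleton {X : Type*} (st : State X) : ℕ × ℕ × List X × List X :=
  (st.phase, st.age, st.active, st.history.map Prod.fst)

/-- The state with a given skeleton on the table of rewards `ω`. -/
noncomputable def State.ofSkeleton {X : Type*} (σ : ℕ × ℕ × List X × List X) (ω : X × ℕ → ℝ) :
    State X :=
  ⟨σ.1, σ.2.1, σ.2.2.1, observations ω σ.2.2.2⟩

section

variable {X : Type*} {len : ℕ → ℕ} {rad : ℕ → ℕ → ℝ → ℝ} {O : List (X × ℝ) → Option X}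
  {tie : List X → X}

/-- Which entry of the table produced a reward is determined by the earlier occurrences of its
strategy, so the list of played strategies recovers the whole history. -/
lemma run_eq_ofSkeleton (ω : X × ℕ → ℝ) (t : ℕ) :
    run len rad O tie ω t = State.ofSkeleton (run len rad O tie ω t).skeleton ω := by
  suffices h : (run len rad O tie ω t).history
      = observations ω ((run len rad O tie ω t).history.map Prod.fst) by
    unfold State.ofSkeleton State.skeleton
    rw [← h]
  induction t with
  | zero => rfl
  | succ t ih =>
    set st := run len rad O tie ω t with hst
    have h : (run len rad O tie ω (t + 1)).history
        = (st.play rad O tie, st.reward (st.play rad O tie) ω) :: st.history := by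
      simp only [run, State.next, ← hst]
      split_ifs <;> rfl
    rw [h, List.map_cons, observations, ← ih, State.reward]
    congr 3
    simp only [List.countP_map]
    rfl

/-- The phase and the active list are dummies here, as `rewards` reads only the age and the history.
-/
lemma measurable_sum_observations (l : List X) (a : ℕ) (v : X) :
    Measurable fun ω => ((State.ofSkeleton (0, a, [], l) ω).rewards v).sum := by
  classical
  induction l generalizing a with
  | nil => simp [State.rewards, State.ofSkeleton, observations]
  | cons x l ih =>
    cases a with
    | zero => simp [State.rewards, State.ofSkeleton]
    | succ a =>
      have h := ih a
      simp only [State.rewards, State.ofSkeleton, observations, List.take_succ_cons,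
        List.filter_cons] at h ⊢
      by_cases hx : x = v
      · simp only [hx, decide_true, if_true, List.map_cons, List.sum_cons]
        exact (measurable_pi_apply _).add h
      · simpa only [hx, decide_false, Bool.false_eq_true, if_false] using h

lemma count_ofSkeleton (σ : ℕ × ℕ × List X × List X) (ω ω' : X × ℕ → ℝ) (v : X) :
    (State.ofSkeleton σ ω).count v = (State.ofSkeleton σ ω').count v := by
  classical
  have h : ∀ ω : X × ℕ → ℝ, (State.ofSkeleton σ ω).count v
      = (((observations ω σ.2.2.2).map Prod.fst).take σ.2.1).countP fun x => x = v := by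
    intro ω
    simp only [State.count, State.rewards, List.length_map, State.ofSkeleton, ← List.map_take,
      List.countP_map, ← List.countP_eq_length_filter]
    rfl
  rw [h, h, map_fst_observations, map_fst_observations]

lemma measurable_avg_ofSkeleton (σ : ℕ × ℕ × List X × List X) (v : X) :
    Measurable fun ω => (State.ofSkeleton σ ω).avg v := by
  unfold State.avg
  -- The count ignores the rewards, so evaluating it on the zero table makes the denominator a
  -- constant.
  simp only [count_ofSkeleton σ _ 0]
  exact (measurable_sum_observations σ.2.2.2 σ.2.1 v).div_const _

lemma discreteMeasurable_radius (hrad : ∀ i n, DiscreteMeasurable (rad i n))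
    (σ : ℕ × ℕ × List X × List X) (v : X) :
    DiscreteMeasurable fun ω => (State.ofSkeleton σ ω).radius rad v := by
  unfold State.radius
  simp only [count_ofSkeleton σ _ 0]
  exact (hrad _ _).comp_measurable (measurable_avg_ofSkeleton σ v)

lemma discreteMeasurable_oracle (hrad : ∀ i n, DiscreteMeasurable (rad i n))
    (σ : ℕ × ℕ × List X × List X) :
    DiscreteMeasurable fun ω => O ((State.ofSkeleton σ ω).active.map fun v =>
      (v, (State.ofSkeleton σ ω).radius rad v)) :=
  (DiscreteMeasurable.map_list (g := fun v ω => (v, (State.ofSkeleton σ ω).radius rad v))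
    (fun v => (discreteMeasurable_radius hrad σ v).comp (v, ·)) σ.2.2.1).comp O

lemma discreteMeasurable_activated (hrad : ∀ i n, DiscreteMeasurable (rad i n))
    (σ : ℕ × ℕ × List X × List X) :
    DiscreteMeasurable fun ω => (State.ofSkeleton σ ω).activated rad O :=
  (discreteMeasurable_oracle hrad σ).comp fun o => σ.2.2.1 ++ o.toList

lemma discreteMeasurable_play (hrad : ∀ i n, DiscreteMeasurable (rad i n))
    (σ : ℕ × ℕ × List X × List X) :
    DiscreteMeasurable fun ω => (State.ofSkeleton σ ω).play rad O tie := by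
  classical
  have hidx : ∀ v, Measurable fun ω => (State.ofSkeleton σ ω).index rad v := fun v =>
    (measurable_avg_ofSkeleton σ v).add
      (((discreteMeasurable_radius hrad σ v).measurable_real id).const_mul 2)
  refine (discreteMeasurable_activated (O := O) hrad σ).bind
    (g := fun l ω => tie (l.filter fun v => ∀ u ∈ l,
      (State.ofSkeleton σ ω).index rad u ≤ (State.ofSkeleton σ ω).index rad v)) fun l => ?_
  refine (DiscreteMeasurable.filter_list (p := fun v ω => ∀ u ∈ l,
    (State.ofSkeleton σ ω).index rad u ≤ (State.ofSkeleton σ ω).index rad v)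
    (fun v => ?_) l).comp tie
  have : {ω | ∀ u ∈ l, (State.ofSkeleton σ ω).index rad u ≤ (State.ofSkeleton σ ω).index rad v}
      = ⋂ u ∈ {u | u ∈ l},
        {ω | (State.ofSkeleton σ ω).index rad u ≤ (State.ofSkeleton σ ω).index rad v} := by
    ext ω
    simp
  rw [this]
  exact MeasurableSet.biInter (List.finite_toSet l).countable
    fun u _ => measurableSet_le (hidx u) (hidx v)

/-- The skeleton takes countably many values, while the state does not; once the skeleton is fixed,
the state is an explicit function of the table. The assumption on round `t` is kept separate because
the induction for the skeleton itself uses this lemma. -/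
lemma discreteMeasurable_of_skeleton {β : Type*} {t : ℕ}
    (ht : DiscreteMeasurable fun ω : X × ℕ → ℝ => (run len rad O tie ω t).skeleton)
    {g : State X → β} (hg : ∀ σ, DiscreteMeasurable fun ω : X × ℕ → ℝ => g (State.ofSkeleton σ ω)) :
    DiscreteMeasurable fun ω => g (run len rad O tie ω t) := by
  have h : ∀ ω, g (run len rad O tie ω t) = (fun σ ω => g (State.ofSkeleton σ ω))
      (run len rad O tie ω t).skeleton ω := fun ω => by
    simp only [← run_eq_ofSkeleton]
  simp only [h]
  exact ht.bind hg

lemma discreteMeasurable_skeleton (hrad : ∀ i n, DiscreteMeasurable (rad i n)) (t : ℕ) :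
    DiscreteMeasurable fun ω : X × ℕ → ℝ => (run len rad O tie ω t).skeleton := by
  induction t with
  | zero => exact DiscreteMeasurable.const (State.init X).skeleton
  | succ t ih =>
    set g : State X → ℕ × ℕ × List X × List X := fun st =>
      if st.age + 1 < len st.phase then
        (st.phase, st.age + 1, st.activated rad O, st.play rad O tie :: st.history.map Prod.fst)
      else (st.phase + 1, 0, [], st.play rad O tie :: st.history.map Prod.fst) with hg
    have h : ∀ ω, (run len rad O tie ω (t + 1)).skeleton = g (run len rad O tie ω t) := by
      intro ω
      simp only [run, State.next, hg]
      split_ifs <;> rfl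
    simp only [h]
    refine discreteMeasurable_of_skeleton ih fun σ => ?_
    have h' : ∀ ω : X × ℕ → ℝ, g (State.ofSkeleton σ ω)
        = (fun l x => if σ.2.1 + 1 < len σ.1 then (σ.1, σ.2.1 + 1, l, x :: σ.2.2.2)
            else (σ.1 + 1, 0, [], x :: σ.2.2.2))
          ((State.ofSkeleton σ ω).activated rad O) ((State.ofSkeleton σ ω).play rad O tie) := by
      intro ω
      have : (State.ofSkeleton σ ω).history.map Prod.fst = σ.2.2.2 := map_fst_observations ω _
      simp only [hg, this]
      rfl
    simp only [h']
    exact (discreteMeasurable_activated hrad σ).bind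
      (g := fun l ω => (fun x => if σ.2.1 + 1 < len σ.1 then (σ.1, σ.2.1 + 1, l, x :: σ.2.2.2)
            else (σ.1 + 1, 0, [], x :: σ.2.2.2)) ((State.ofSkeleton σ ω).play rad O tie))
      fun l => (discreteMeasurable_play hrad σ).comp
        fun x => if σ.2.1 + 1 < len σ.1 then (σ.1, σ.2.1 + 1, l, x :: σ.2.2.2)
          else (σ.1 + 1, 0, [], x :: σ.2.2.2)

lemma discreteMeasurable_run {β : Type*} (hrad : ∀ i n, DiscreteMeasurable (rad i n)) (t : ℕ)
    {g : State X → β} (hg : ∀ σ, DiscreteMeasurable fun ω : X × ℕ → ℝ => g (State.ofSkeleton σ ω)) :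
    DiscreteMeasurable fun ω => g (run len rad O tie ω t) :=
  discreteMeasurable_of_skeleton (discreteMeasurable_skeleton hrad t) hg

lemma discreteMeasurable_played (hrad : ∀ i n, DiscreteMeasurable (rad i n)) (t : ℕ) :
    DiscreteMeasurable (played len rad O tie t) :=
  discreteMeasurable_run hrad t (g := fun st => st.play rad O tie)
    (discreteMeasurable_play hrad)

open Classical in
/-- The number of plays of `x` in all phases so far. -/
noncomputable def State.total (st : State X) (x : X) : ℕ := st.history.countP fun p => p.1 = x

lemma discreteMeasurable_total (hrad : ∀ i n, DiscreteMeasurable (rad i n)) (t : ℕ) (x : X) :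
    DiscreteMeasurable fun ω => (run len rad O tie ω t).total x := by
  classical
  refine discreteMeasurable_run hrad t (g := fun st => st.total x) fun σ => ?_
  have : (fun ω : X × ℕ → ℝ => (State.ofSkeleton σ ω).total x)
      = fun ω => σ.2.2.2.countP fun y => y = x := by
    funext ω
    conv_rhs => rw [← map_fst_observations ω σ.2.2.2]
    rw [List.countP_map]
    rfl
  rw [this]
  exact DiscreteMeasurable.const _

theorem wellPosed (hrad : ∀ i n, DiscreteMeasurable (rad i n)) : WellPosed len rad O tie :=
  fun t => discreteMeasurable_played hrad t

/-! ### The run depends only on the rewards seen so far -/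

lemma history_run_succ (ω : X × ℕ → ℝ) (t : ℕ) : (run len rad O tie ω (t + 1)).history
    = (played len rad O tie t ω, payoff len rad O tie t ω) ::
      (run len rad O tie ω t).history := by
  simp only [run, State.next]
  split_ifs <;> rfl

open Classical in
lemma total_run_succ (ω : X × ℕ → ℝ) (t : ℕ) (x : X) : (run len rad O tie ω (t + 1)).total x
    = (run len rad O tie ω t).total x + if played len rad O tie t ω = x then 1 else 0 := by
  simp [State.total, history_run_succ, List.countP_cons]

lemma payoff_eq (ω : X × ℕ → ℝ) (t : ℕ) : payoff len rad O tie t ω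
    = ω (played len rad O tie t ω, (run len rad O tie ω t).total (played len rad O tie t ω)) :=
  rfl

/-- The trial consumed in round `t` has number `total` of the played strategy, which is below its
`total` one round later; hence the hypothesis covers it. -/
lemma run_congr {ω ω' : X × ℕ → ℝ} {t : ℕ}
    (h : ∀ x j, j < (run len rad O tie ω t).total x → ω (x, j) = ω' (x, j)) :
    run len rad O tie ω' t = run len rad O tie ω t := by
  classical
  induction t with
  | zero => rfl
  | succ t ih =>
    have ih' := ih fun x j hj => h x j (by rw [total_run_succ]; omega)
    simp only [run, ih']
    congr 1
    refine (h _ _ ?_).symm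
    rw [total_run_succ]
    erw [if_pos rfl]
    exact Nat.lt_succ_self _

end

/-! ### Adaptively chosen observables -/

/-- If the discrete choice `f ω = b` does not depend on the coordinates in `S b`, and the observable
`F b` depends on them only, then the adaptively chosen observable has the expected mean. -/
lemma lintegral_adaptive {ι E β : Type*} [MeasurableSpace E] (μ : ι → Measure E)
    [∀ i, IsProbabilityMeasure (μ i)] {f : (ι → E) → β} (hf : DiscreteMeasurable f)
    (S : β → Set ι) (hfS : ∀ b, ∀ ω ω' : ι → E, (∀ p ∉ S b, ω p = ω' p) → f ω = b → f ω' = b)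
    {F : β → (ι → E) → ℝ≥0∞} (hF : ∀ b, Measurable (F b))
    (hFS : ∀ b, ∀ ω ω' : ι → E, (∀ p ∈ S b, ω p = ω' p) → F b ω = F b ω') :
    ∫⁻ ω, F (f ω) ω ∂(Measure.infinitePi μ)
      = ∫⁻ ω, (∫⁻ ω', F (f ω) ω' ∂(Measure.infinitePi μ)) ∂(Measure.infinitePi μ) := by
  set P := Measure.infinitePi μ
  -- The fibres of `f` form a countable measurable partition. On each one the observable is fixed
  -- and independent of the event of being there.
  have hU : (⋃ b ∈ Set.range f, {ω | f ω = b}) = Set.univ := by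
    ext ω
    simp
  have hd : (Set.range f).PairwiseDisjoint (fun b => {ω | f ω = b}) := by
    intro b _ c _ hbc
    exact Set.disjoint_left.mpr fun ω h h' => hbc (h.symm.trans h')
  have key : ∀ g : (ι → E) → ℝ≥0∞, ∫⁻ ω, g ω ∂P
      = ∑' b : Set.range f, ∫⁻ ω in {ω | f ω = b}, g ω ∂P := by
    intro g
    rw [← lintegral_biUnion hf.1 (fun b _ => hf.2 b) hd, hU, Measure.restrict_univ]
  rw [key, key]
  refine tsum_congr fun b => ?_
  calc ∫⁻ ω in {ω | f ω = b}, F (f ω) ω ∂P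
      = ∫⁻ ω in {ω | f ω = b}, F b ω ∂P :=
        setLIntegral_congr_fun (hf.2 b) fun ω (hω : f ω = b) => by simp only [hω]
    _ = P {ω | f ω = b} * ∫⁻ ω, F b ω ∂P := by
        rw [← lintegral_indicator (hf.2 b)]
        exact lintegral_indicator_infinitePi μ (S b) (hf.2 b) (hfS b) (hF b) (hFS b)
    _ = ∫⁻ ω in {ω | f ω = b}, (∫⁻ ω', F b ω' ∂P) ∂P := by
        rw [setLIntegral_const, mul_comm]
    _ = ∫⁻ ω in {ω | f ω = b}, (∫⁻ ω', F (f ω) ω' ∂P) ∂P :=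
        setLIntegral_congr_fun (hf.2 b) fun ω (hω : f ω = b) => by simp only [hω]

/-- This replaces a union bound over the possible values of `f`: the event is selected without
looking at the coordinates that decide it, so the selection costs no factor. -/
lemma measure_adaptive_le {ι E β : Type*} [MeasurableSpace E] (μ : ι → Measure E)
    [∀ i, IsProbabilityMeasure (μ i)] {f : (ι → E) → β} (hf : DiscreteMeasurable f)
    (S : β → Set ι) (hfS : ∀ b, ∀ ω ω' : ι → E, (∀ p ∉ S b, ω p = ω' p) → f ω = b → f ω' = b)
    {A : β → Set (ι → E)} (hA : ∀ b, MeasurableSet (A b))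
    (hAS : ∀ b, ∀ ω ω' : ι → E, (∀ p ∈ S b, ω p = ω' p) → (ω ∈ A b ↔ ω' ∈ A b))
    {q : ℝ≥0∞} (hq : ∀ b, Measure.infinitePi μ (A b) ≤ q) :
    Measure.infinitePi μ {ω | ω ∈ A (f ω)} ≤ q := by
  rw [← lintegral_indicator_one (hf.measurableSet_bind hA)]
  refine (lintegral_adaptive μ hf S hfS (F := fun b => (A b).indicator 1)
    (fun b => measurable_one.indicator (hA b)) fun b ω ω' h => ?_).trans_le ?_
  · have e := hAS b ω ω' h
    by_cases h1 : ω' ∈ A b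
    · simp [h1, e.mpr h1]
    · simp [h1, mt e.mp h1]
  · calc _ ≤ ∫⁻ _ω, q ∂(Measure.infinitePi μ) :=
          lintegral_mono fun ω => (lintegral_indicator_one (hA _)).trans_le (hq _)
      _ = q := by simp

/-- The event that the average of the `n` trials of `v` from the `k`-th on is further from the mean
than the confidence radius. -/
def deviation {X : Type*} (D : X → Measure ℝ) (α : ℝ) (v : X) (k n : ℕ) : Set (X × ℕ → ℝ) :=
  {ω | refinedRadius α n ((∑ j ∈ Finset.range n, ω (v, k + j)) / n)
    < |(∑ j ∈ Finset.range n, ω (v, k + j)) / n - mean D v|}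

lemma measurableSet_deviation {X : Type*} (D : X → Measure ℝ) (α : ℝ) (v : X) (k n : ℕ) :
    MeasurableSet (deviation D α v k n) := by
  have h : Measurable fun ω : X × ℕ → ℝ => (∑ j ∈ Finset.range n, ω (v, k + j)) / n := by
    fun_prop
  exact measurableSet_lt ((measurable_refinedRadius α n).comp h) ((h.sub_const _).norm)

/-! ### Expected payoffs -/

section

variable {X : Type*} {len : ℕ → ℕ} {rad : ℕ → ℕ → ℝ → ℝ} {O : List (X × ℝ) → Option X}
  {tie : List X → X} {D : X → Measure ℝ} [∀ x, IsProbabilityMeasure (D x)]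

instance : IsProbabilityMeasure (rewardLaw D) := by
  unfold rewardLaw
  infer_instance

lemma map_eval_rewardLaw (p : X × ℕ) : (rewardLaw D).map (fun ω => ω p) = D p.1 :=
  Measure.infinitePi_map_eval _ p

lemma integrable_of_mem_Icc {Ω : Type*} [MeasurableSpace Ω] {P : Measure Ω} [IsFiniteMeasure P]
    {f : Ω → ℝ} (hf : Measurable f) (h : ∀ᵐ ω ∂P, f ω ∈ Set.Icc (0 : ℝ) 1) : Integrable f P :=
  Integrable.of_mem_Icc 0 1 hf.aemeasurable h

lemma mean_mem_Icc {x : X} (hD : ∀ᵐ y ∂(D x), y ∈ Set.Icc (0 : ℝ) 1) :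
    mean D x ∈ Set.Icc (0 : ℝ) 1 := by
  constructor
  · exact integral_nonneg_of_ae (hD.mono fun y hy => hy.1)
  · have := integral_mono_ae (integrable_of_mem_Icc measurable_id hD)
      (integrable_const (μ := D x) (1 : ℝ)) (hD.mono fun y hy => hy.2)
    simpa [mean] using this

lemma ae_mem_Icc (hD : ∀ x, ∀ᵐ y ∂(D x), y ∈ Set.Icc (0 : ℝ) 1) (p : X × ℕ) :
    ∀ᵐ ω ∂(rewardLaw D), ω p ∈ Set.Icc (0 : ℝ) 1 := by
  have h := hD p.1
  rw [← map_eval_rewardLaw (D := D) p] at h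
  exact ae_of_ae_map (measurable_pi_apply p).aemeasurable h

lemma integral_reward (p : X × ℕ) : ∫ ω, ω p ∂(rewardLaw D) = mean D p.1 := by
  rw [mean, ← map_eval_rewardLaw (D := D) p]
  exact (integral_map (φ := fun ω : X × ℕ → ℝ => ω p) (f := fun y : ℝ => y)
    (measurable_pi_apply p).aemeasurable aestronglyMeasurable_id).symm

lemma lintegral_reward (hD : ∀ x, ∀ᵐ y ∂(D x), y ∈ Set.Icc (0 : ℝ) 1) (p : X × ℕ) :
    ∫⁻ ω, ENNReal.ofReal (ω p) ∂(rewardLaw D) = ENNReal.ofReal (mean D p.1) := by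
  rw [← integral_reward, ofReal_integral_eq_lintegral_ofReal
      (integrable_of_mem_Icc (measurable_pi_apply p) (ae_mem_Icc hD p))
      ((ae_mem_Icc hD p).mono fun ω h => h.1)]

lemma discreteMeasurable_trial (hrad : ∀ i n, DiscreteMeasurable (rad i n)) (t : ℕ) :
    DiscreteMeasurable fun ω => (played len rad O tie t ω,
      (run len rad O tie ω t).total (played len rad O tie t ω)) :=
  (discreteMeasurable_played hrad t).bind
    (g := fun x ω => (x, (run len rad O tie ω t).total x))
    fun x => (discreteMeasurable_total hrad t x).comp (x, ·)

lemma measurable_payoff (hrad : ∀ i n, DiscreteMeasurable (rad i n)) (t : ℕ) :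
    Measurable (payoff len rad O tie t) := by
  exact fun s hs => (discreteMeasurable_trial hrad t).measurableSet_bind
    (A := fun p => {ω | ω p ∈ s}) fun p => measurable_pi_apply p hs

lemma ae_payoff_mem_Icc (hrad : ∀ i n, DiscreteMeasurable (rad i n))
    (hD : ∀ x, ∀ᵐ y ∂(D x), y ∈ Set.Icc (0 : ℝ) 1) :
    ∀ᵐ ω ∂(rewardLaw D), ∀ t, payoff len rad O tie t ω ∈ Set.Icc (0 : ℝ) 1 := by
  refine ae_all_iff.mpr fun t => ?_
  have hf := discreteMeasurable_trial (len := len) (O := O) (tie := tie) hrad t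
  have h := (ae_ball_iff hf.1).mpr fun p _ => ae_mem_Icc hD p
  exact h.mono fun ω hω => hω _ ⟨ω, rfl⟩

/-- The future rewards of a strategy are independent of the past. -/
lemma run_congr_of_total_eq {ω ω' : X × ℕ → ℝ} {t : ℕ} {v : X} {k : ℕ}
    (h : ∀ p ∉ {p : X × ℕ | p.1 = v ∧ k ≤ p.2}, ω p = ω' p)
    (hk : (run len rad O tie ω t).total v = k) :
    run len rad O tie ω' t = run len rad O tie ω t := by
  refine run_congr fun x j hj => h _ ?_
  rintro ⟨rfl, hkj⟩
  have : (run len rad O tie ω t).total x ≤ j := hk.trans_le hkj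
  omega

/-- If the next trial is number `k` of `v`, this choice was made without the trials of `v` from `k`
on, so the reward has mean `mean D v` given the choice. -/
lemma integral_payoff (hrad : ∀ i n, DiscreteMeasurable (rad i n))
    (hD : ∀ x, ∀ᵐ y ∂(D x), y ∈ Set.Icc (0 : ℝ) 1) (t : ℕ) :
    ∫ ω, payoff len rad O tie t ω ∂(rewardLaw D)
      = ∫ ω, mean D (played len rad O tie t ω) ∂(rewardLaw D) := by
  have hm := (discreteMeasurable_played (len := len) (O := O) (tie := tie) hrad t).measurable_real
    (mean D)
  rw [integral_eq_lintegral_of_nonneg_ae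
      ((ae_payoff_mem_Icc hrad hD).mono fun ω h => (h t).1)
      (measurable_payoff hrad t).aestronglyMeasurable,
    integral_eq_lintegral_of_nonneg_ae
      (Filter.Eventually.of_forall fun ω => (mean_mem_Icc (hD _)).1) hm.aestronglyMeasurable]
  congr 1
  have h := lintegral_adaptive (fun p : X × ℕ => D p.1)
    (discreteMeasurable_trial (len := len) (O := O) (tie := tie) hrad t)
    (fun p => {q : X × ℕ | q.1 = p.1 ∧ p.2 ≤ q.2}) ?_ (F := fun p ω => ENNReal.ofReal (ω p))
    (fun p => (measurable_pi_apply p).ennreal_ofReal)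
    (fun p ω ω' h => by simp only [h p ⟨rfl, le_rfl⟩])
  · refine h.trans (lintegral_congr fun ω => ?_)
    exact lintegral_reward hD _
  · rintro ⟨v, k⟩ ω ω' h hω
    simp only [Prod.mk.injEq] at hω
    have hr := run_congr_of_total_eq h (hω.1 ▸ hω.2)
    simpa [played, hr] using hω

/-! ### Concentration -/

/-- The chord of `exp` over `[0, l]`, followed by `1 + x ≤ exp x`. Losses are used instead of
rewards so that the variance proxy is `1 - μ`, as in the confidence radius. -/
lemma mgf_one_sub_le {Ω : Type*} [MeasurableSpace Ω] {P : Measure Ω} [IsProbabilityMeasure P]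
    {Y : Ω → ℝ} (hY : Measurable Y) (h : ∀ᵐ ω ∂P, Y ω ∈ Set.Icc (0 : ℝ) 1) (l : ℝ) :
    ProbabilityTheory.mgf (fun ω => 1 - Y ω) P l
      ≤ Real.exp ((1 - ∫ ω, Y ω ∂P) * (Real.exp l - 1)) := by
  have hi := integrable_of_mem_Icc hY h
  have hb : ∀ᵐ ω ∂P, Real.exp (l * (1 - Y ω)) ≤ 1 + (1 - Y ω) * (Real.exp l - 1) := by
    refine h.mono fun ω hω => ?_
    have := convexOn_exp.2 (Set.mem_univ (0 : ℝ)) (Set.mem_univ l) hω.1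
      (sub_nonneg.mpr hω.2) (by ring)
    simp only [smul_eq_mul, mul_zero, zero_add, Real.exp_zero, mul_one] at this
    rw [mul_comm l]
    linarith
  have hi1 : Integrable (fun ω => (1 - Y ω) * (Real.exp l - 1)) P :=
    ((integrable_const _).sub hi).mul_const _
  have hi2 : Integrable (fun ω => 1 + (1 - Y ω) * (Real.exp l - 1)) P :=
    (integrable_const _).add hi1
  calc ProbabilityTheory.mgf (fun ω => 1 - Y ω) P l
      ≤ ∫ ω, (1 + (1 - Y ω) * (Real.exp l - 1)) ∂P :=
        integral_mono_of_nonneg (Filter.Eventually.of_forall fun ω => (Real.exp_pos _).le) hi2 hb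
    _ = (1 - ∫ ω, Y ω ∂P) * (Real.exp l - 1) + 1 := by
        rw [integral_add (integrable_const _) hi1,
          integral_mul_const, integral_sub (integrable_const _) hi]
        simp
        ring
    _ ≤ _ := Real.add_one_le_exp _

/-- A Chernoff bound with `exp l - 1 ≤ l + l ^ 2`. The parameter `l` may have either sign, which
covers both tails at once. -/
lemma measure_sum_deviation_le (hD : ∀ x, ∀ᵐ y ∂(D x), y ∈ Set.Icc (0 : ℝ) 1) (v : X)
    (k n : ℕ) {l : ℝ} (hl : |l| ≤ 1) (a : ℝ) :
    rewardLaw D {ω | a + n * (1 - mean D v) * l ^ 2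
        ≤ l * (∑ j ∈ Finset.range n, (1 - ω (v, k + j)) - n * (1 - mean D v))}
      ≤ ENNReal.ofReal (Real.exp (-a)) := by
  set z := 1 - mean D v with hz
  have hz0 : 0 ≤ z := sub_nonneg.mpr (mean_mem_Icc (hD v)).2
  have hind : ProbabilityTheory.iIndepFun (fun (j : ℕ) (ω : X × ℕ → ℝ) => 1 - ω (v, k + j))
      (rewardLaw D) := by
    have h1 := ProbabilityTheory.iIndepFun_infinitePi (P := fun p : X × ℕ => D p.1)
      (X := fun _ (y : ℝ) => 1 - y) (fun _ => by fun_prop)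
    exact h1.precomp (g := fun j : ℕ => (v, k + j)) fun i j h => by simpa using h
  have hmeas : ∀ j : ℕ, Measurable (fun ω : X × ℕ → ℝ => 1 - ω (v, k + j)) := fun j =>
    measurable_const.sub (measurable_pi_apply _)
  have hmgf : ProbabilityTheory.mgf (∑ j ∈ Finset.range n, fun ω : X × ℕ → ℝ => 1 - ω (v, k + j))
      (rewardLaw D) l ≤ Real.exp (n * z * (l + l ^ 2)) := by
    rw [hind.mgf_sum hmeas]
    calc _ ≤ ∏ j ∈ Finset.range n, Real.exp (z * (l + l ^ 2)) := by
          refine Finset.prod_le_prod (fun _ _ => ProbabilityTheory.mgf_nonneg) fun j _ => ?_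
          refine (mgf_one_sub_le (measurable_pi_apply _) (ae_mem_Icc hD _) l).trans ?_
          rw [integral_reward]
          apply Real.exp_le_exp.mpr
          apply mul_le_mul_of_nonneg_left _ hz0
          have := (abs_le.mp (Real.abs_exp_sub_one_sub_id_le hl)).2
          linarith
      _ = _ := by
          rw [Finset.prod_const, Finset.card_range, ← Real.exp_nat_mul]
          ring_nf
  have hint : Integrable (fun ω : X × ℕ → ℝ =>
      Real.exp (l * (∑ j ∈ Finset.range n, fun ω : X × ℕ → ℝ => 1 - ω (v, k + j)) ω))
      (rewardLaw D) := by
    refine hind.integrable_exp_mul_sum hmeas fun j _ => ?_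
    refine Integrable.of_mem_Icc (Real.exp (-|l|)) (Real.exp |l|)
      ((hmeas j).const_mul l).exp.aemeasurable ?_
    refine (ae_mem_Icc hD (v, k + j)).mono fun ω hω => ?_
    have : |l * (1 - ω (v, k + j))| ≤ |l| := by
      rw [abs_mul]
      refine mul_le_of_le_one_right (abs_nonneg _) (abs_le.mpr ⟨?_, ?_⟩) <;> linarith [hω.1, hω.2]
    exact ⟨Real.exp_le_exp.mpr (abs_le.mp this).1, Real.exp_le_exp.mpr (abs_le.mp this).2⟩
  -- The Chernoff inequality requires a nonnegative parameter; it is applied with parameter `1` to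
  -- `l` times the sum.
  have hch := ProbabilityTheory.measure_ge_le_exp_mul_mgf (μ := rewardLaw D) (t := 1)
    (X := fun ω => l * (∑ j ∈ Finset.range n, fun ω : X × ℕ → ℝ => 1 - ω (v, k + j)) ω)
    (a + n * z * l ^ 2 + l * (n * z)) zero_le_one (by simpa using hint)
  rw [← ENNReal.ofReal_toReal (measure_ne_top (rewardLaw D) _)]
  apply ENNReal.ofReal_le_ofReal
  have hset : {ω : X × ℕ → ℝ | a + n * z * l ^ 2
        ≤ l * (∑ j ∈ Finset.range n, (1 - ω (v, k + j)) - n * z)}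
      = {ω | a + n * z * l ^ 2 + l * (n * z)
        ≤ l * (∑ j ∈ Finset.range n, fun ω : X × ℕ → ℝ => 1 - ω (v, k + j)) ω} := by
    ext ω
    simp only [Set.mem_ofPred_eq, Finset.sum_apply, mul_sub l (Finset.sum _ _) (_ : ℝ),
      le_sub_iff_add_le]
  rw [hset]
  refine hch.trans ?_
  have he : ProbabilityTheory.mgf
      (fun ω => l * (∑ j ∈ Finset.range n, fun ω : X × ℕ → ℝ => 1 - ω (v, k + j)) ω)
      (rewardLaw D) 1 = ProbabilityTheory.mgf
      (∑ j ∈ Finset.range n, fun ω : X × ℕ → ℝ => 1 - ω (v, k + j)) (rewardLaw D) l := by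
    simp only [ProbabilityTheory.mgf, one_mul]
  rw [he]
  calc _ ≤ Real.exp (-1 * (a + n * z * l ^ 2 + l * (n * z))) * Real.exp (n * z * (l + l ^ 2)) := by
        gcongr
    _ = _ := by
        rw [← Real.exp_add]
        ring_nf

/-- Two-sided control of the exponential deviations gives the confidence radius. -/
lemma abs_sub_le_refinedRadius {a z m l : ℝ} {n : ℕ} (hn : n ≠ 0) (ha : 0 < a)
    (hm : m ≤ 1) (hl : l = if n * z ≤ a then 1 else √(a / (n * z)))
    (h1 : l * (n * (1 - m) - n * z) < a + n * z * l ^ 2)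
    (h2 : -l * (n * (1 - m) - n * z) < a + n * z * l ^ 2) :
    |m - (1 - z)| ≤ refinedRadius (16 * a) n m := by
  have hn1 : (1 : ℝ) ≤ n := by exact_mod_cast Nat.one_le_iff_ne_zero.mpr hn
  have hn0 : (0 : ℝ) < n := by linarith
  set d := |n * (1 - m) - n * z| with hd
  have hdn : |m - (1 - z)| = d / n := by
    rw [eq_div_iff hn0.ne', hd, ← mul_sub, abs_mul, abs_of_pos hn0, mul_comm, abs_sub_comm]
    ring_nf
  have hl0 : 0 ≤ l := by
    rw [hl]
    split_ifs
    · exact zero_le_one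
    · exact Real.sqrt_nonneg _
  have h3 : l * d < a + n * z * l ^ 2 := by
    rcases abs_cases (n * (1 - m) - n * z) with h | h
    · rw [hd, h.1]
      exact h1
    · rw [hd, h.1]
      linarith
  have hd0 : 0 ≤ d := abs_nonneg _
  -- The bound must involve the observed loss `1 - m`, not the true `z`. The choice of `l` balances
  -- both terms and gives `d ≤ 2 a` or `d ^ 2 ≤ 4 a n z`; then `n z ≤ n (1 - m) + d`, and for `d > 8
  -- a` the term `4 a d` is absorbed into `d ^ 2 / 2`.
  have hkey : d ≤ 8 * a ∨ d ^ 2 ≤ 8 * a * (n * (1 - m)) := by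
    by_cases hc : n * z ≤ a
    · rw [if_pos hc] at hl
      rw [hl] at h3
      left
      linarith
    · rw [if_neg hc] at hl
      push Not at hc
      have hnz : 0 < n * z := ha.trans hc
      have hl2 : l ^ 2 = a / (n * z) := by rw [hl, Real.sq_sqrt (by positivity)]
      have h4 : n * z * l ^ 2 = a := by
        rw [hl2, mul_div_cancel₀ _ hnz.ne']
      rw [h4] at h3
      have h5 : (l * d) ^ 2 ≤ (a + a) ^ 2 := by gcongr
      have h6 : d ^ 2 ≤ 4 * a * (n * z) := by
        have : n * z * (l * d) ^ 2 = a * d ^ 2 := by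
          rw [mul_pow, ← mul_assoc, h4]
        have h7 : a * d ^ 2 ≤ n * z * (a + a) ^ 2 := by
          rw [← this]
          gcongr
        have : a * d ^ 2 ≤ a * (4 * a * (n * z)) := by linarith
        exact le_of_mul_le_mul_left this ha
      have h8 : n * z ≤ n * (1 - m) + d := by
        have := neg_abs_le (n * (1 - m) - n * z)
        linarith
      by_cases h9 : d ≤ 8 * a
      · exact Or.inl h9
      · right
        push Not at h9
        nlinarith
  rw [hdn, div_le_iff₀ hn0]
  -- Replacing `n` by `1 + n` in the denominators costs a factor two, which turns `8 a` into `16 a`.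
  have hhalf : (1 : ℝ) / 2 ≤ n / (1 + n) := by
    rw [div_le_div_iff₀ (by norm_num) (by positivity)]
    linarith
  have h1m : 0 ≤ 1 - m := sub_nonneg.mpr hm
  unfold refinedRadius
  rw [add_mul]
  rcases hkey with h | h
  · have : 8 * a ≤ 16 * a / (1 + n) * n := by
      rw [div_mul_eq_mul_div, mul_div_assoc]
      nlinarith
    have := Real.sqrt_nonneg (16 * a * (1 - m) / (1 + n))
    nlinarith
  · have : d ≤ √(16 * a * (1 - m) / (1 + n)) * n := by
      refine (abs_le_of_sq_le_sq' ?_ (by positivity)).2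
      rw [mul_pow, Real.sq_sqrt (by positivity)]
      have : 16 * a * (1 - m) / (1 + n) * n ^ 2 = 16 * a * (1 - m) * n * (n / (1 + n)) := by
        field_simp
      rw [this]
      have : 0 ≤ 16 * a * (1 - m) * n := by positivity
      nlinarith
    have : 0 ≤ 16 * a / (1 + n) * n := by positivity
    linarith

/-- The optimal Chernoff parameter `l` depends on the true mean only, so it is deterministic; the
two events with `l` and `-l` contain the deviation up to a null set. -/
lemma measure_deviation_le (hD : ∀ x, ∀ᵐ y ∂(D x), y ∈ Set.Icc (0 : ℝ) 1) {a : ℝ} (ha : 0 < a)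
    (v : X) (k : ℕ) {n : ℕ} (hn : n ≠ 0) :
    rewardLaw D (deviation D (16 * a) v k n) ≤ 2 * ENNReal.ofReal (Real.exp (-a)) := by
  set z := 1 - mean D v with hz
  obtain ⟨l, hl⟩ : ∃ l : ℝ, l = if n * z ≤ a then 1 else √(a / (n * z)) := ⟨_, rfl⟩
  have hl1 : |l| ≤ 1 := by
    rw [hl]
    split_ifs with h
    · simp
    · push Not at h
      rw [abs_of_nonneg (Real.sqrt_nonneg _), Real.sqrt_le_one]
      exact div_le_one_of_le₀ h.le (ha.le.trans h.le)
  have h1 := measure_sum_deviation_le hD v k n hl1 a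
  have h2 := measure_sum_deviation_le hD v k n (l := -l) (by rwa [abs_neg]) a
  rw [two_mul]
  refine le_trans ?_ (add_le_add h1 h2)
  refine le_trans (measure_mono_ae ?_) (measure_union_le _ _)
  have hae : ∀ᵐ ω ∂(rewardLaw D), ∀ j : ℕ, ω (v, k + j) ∈ Set.Icc (0 : ℝ) 1 :=
    ae_all_iff.mpr fun j => ae_mem_Icc hD _
  refine hae.mono fun ω hω hdev => ?_
  by_contra hnot
  have hn0 : (0 : ℝ) < n := by exact_mod_cast Nat.pos_of_ne_zero hn
  have hnot' : ω ∉ {ω | a + n * z * l ^ 2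
        ≤ l * (∑ j ∈ Finset.range n, (1 - ω (v, k + j)) - n * z)} ∪
      {ω | a + n * z * (-l) ^ 2
        ≤ -l * (∑ j ∈ Finset.range n, (1 - ω (v, k + j)) - n * z)} := hnot
  simp only [Set.mem_union, Set.mem_ofPred_eq, not_or, not_le] at hnot'
  set m := (∑ j ∈ Finset.range n, ω (v, k + j)) / n with hm
  have hsum : ∑ j ∈ Finset.range n, (1 - ω (v, k + j)) = n * (1 - m) := by
    rw [Finset.sum_sub_distrib, hm, mul_sub, mul_div_cancel₀ _ hn0.ne']
    simp
  have hm1 : m ≤ 1 := by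
    rw [hm, div_le_one hn0]
    calc _ ≤ ∑ j ∈ Finset.range n, (1 : ℝ) := Finset.sum_le_sum fun j _ => (hω j).2
      _ = n := by simp
  rw [hsum, neg_sq] at hnot'
  have := abs_sub_le_refinedRadius hn ha hm1 hl hnot'.1 hnot'.2
  rw [hz, sub_sub_cancel] at this
  exact absurd hdev (not_lt.mpr this)

end

/-! ### The structure of a phase -/

/-- The number of rounds before phase `i`. -/
def phaseStart (len : ℕ → ℕ) (i : ℕ) : ℕ := ∑ j ∈ Finset.range i, len j

/-- The answer of the covering oracle in state `st`. -/
noncomputable def State.answer {X : Type*} (rad : ℕ → ℕ → ℝ → ℝ) (O : List (X × ℝ) → Option X)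
    (st : State X) : Option X :=
  O (st.active.map fun v => (v, st.radius rad v))

/-- The state at age `a` of phase `i`. -/
noncomputable def runPhase {X : Type*} (len : ℕ → ℕ) (rad : ℕ → ℕ → ℝ → ℝ)
    (O : List (X × ℝ) → Option X) (tie : List X → X) (ω : X × ℕ → ℝ) (i a : ℕ) : State X :=
  run len rad O tie ω (phaseStart len i + a)

section

variable {X : Type*} {len : ℕ → ℕ} {rad : ℕ → ℕ → ℝ → ℝ} {O : List (X × ℝ) → Option X}
  {tie : List X → X} {ω : X × ℕ → ℝ} {i : ℕ}

lemma State.activated_eq (st : State X) :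
    st.activated rad O = st.active ++ (st.answer rad O).toList := rfl

lemma runPhase_zero (hlen : ∀ i, 0 < len i) :
    (runPhase len rad O tie ω i 0).phase = i ∧ (runPhase len rad O tie ω i 0).age = 0 ∧
      (runPhase len rad O tie ω i 0).active = [] := by
  induction i with
  | zero => exact ⟨rfl, rfl, rfl⟩
  | succ i ih =>
    have h : ∀ a, a < len i → (runPhase len rad O tie ω i a).phase = i ∧
        (runPhase len rad O tie ω i a).age = a := by
      intro a
      induction a with
      | zero => exact fun _ => ⟨ih.1, ih.2.1⟩
      | succ a iha =>
        intro ha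
        have h := iha (by omega)
        have e : runPhase len rad O tie ω i (a + 1) = (runPhase len rad O tie ω i a).next len rad O
          tie ((runPhase len rad O tie ω i a).reward
            ((runPhase len rad O tie ω i a).play rad O tie) ω) := rfl
        rw [e, State.next, if_pos (by rw [h.1, h.2]; exact ha)]
        exact ⟨h.1, by simp only [h.2]⟩
    have h1 := h (len i - 1) (Nat.sub_lt (hlen i) one_pos)
    have e : runPhase len rad O tie ω (i + 1) 0
        = (runPhase len rad O tie ω i (len i - 1)).next len rad O tie
          ((runPhase len rad O tie ω i (len i - 1)).reward
            ((runPhase len rad O tie ω i (len i - 1)).play rad O tie) ω) := by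
      have : phaseStart len (i + 1) + 0 = phaseStart len i + (len i - 1) + 1 := by
        have := hlen i
        simp only [phaseStart, Finset.sum_range_succ]
        omega
      rw [runPhase, this]
      rfl
    have hl := hlen i
    rw [e, State.next, if_neg (by rw [h1.1, h1.2]; omega)]
    exact ⟨by simp only [h1.1], rfl, rfl⟩

lemma runPhase_phase_age (hlen : ∀ i, 0 < len i) {a : ℕ} (ha : a < len i) :
    (runPhase len rad O tie ω i a).phase = i ∧ (runPhase len rad O tie ω i a).age = a := by
  induction a with
  | zero => exact ⟨(runPhase_zero hlen).1, (runPhase_zero hlen).2.1⟩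
  | succ a iha =>
    have h := iha (by omega)
    have e : runPhase len rad O tie ω i (a + 1) = (runPhase len rad O tie ω i a).next len rad O
      tie ((runPhase len rad O tie ω i a).reward
        ((runPhase len rad O tie ω i a).play rad O tie) ω) := rfl
    rw [e, State.next, if_pos (by rw [h.1, h.2]; exact ha)]
    exact ⟨h.1, by simp only [h.2]⟩

lemma runPhase_succ (hlen : ∀ i, 0 < len i) {a : ℕ} (ha : a + 1 < len i) :
    runPhase len rad O tie ω i (a + 1) = ⟨i, a + 1, (runPhase len rad O tie ω i a).activated rad O,
      (played len rad O tie (phaseStart len i + a) ω,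
        payoff len rad O tie (phaseStart len i + a) ω) ::
          (runPhase len rad O tie ω i a).history⟩ := by
  have h := runPhase_phase_age (rad := rad) (O := O) (tie := tie) (ω := ω) hlen
    (show a < len i by omega)
  have e : runPhase len rad O tie ω i (a + 1) = (runPhase len rad O tie ω i a).next len rad O
    tie ((runPhase len rad O tie ω i a).reward
      ((runPhase len rad O tie ω i a).play rad O tie) ω) := rfl
  rw [e, State.next, if_pos (by rw [h.1, h.2]; exact ha), h.1, h.2]
  rfl

lemma rewards_runPhase_zero (hlen : ∀ i, 0 < len i) (v : X) :
    (runPhase len rad O tie ω i 0).rewards v = [] := by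
  simp [State.rewards, (runPhase_zero hlen).2.1]

open Classical in
lemma rewards_runPhase_succ (hlen : ∀ i, 0 < len i) {a : ℕ} (ha : a + 1 < len i) (v : X) :
    (runPhase len rad O tie ω i (a + 1)).rewards v =
      if played len rad O tie (phaseStart len i + a) ω = v then
        payoff len rad O tie (phaseStart len i + a) ω :: (runPhase len rad O tie ω i a).rewards v
      else (runPhase len rad O tie ω i a).rewards v := by
  have h := runPhase_phase_age (rad := rad) (O := O) (tie := tie) (ω := ω) hlen
    (show a < len i by omega)
  rw [runPhase_succ hlen ha]
  simp only [State.rewards, List.take_succ_cons, h.2, List.filter_cons, decide_eq_true_eq]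
  split_ifs <;> rfl

lemma count_runPhase_zero (hlen : ∀ i, 0 < len i) (v : X) :
    (runPhase len rad O tie ω i 0).count v = 0 := by
  rw [State.count, rewards_runPhase_zero hlen, List.length_nil]

open Classical in
lemma count_runPhase_succ (hlen : ∀ i, 0 < len i) {a : ℕ} (ha : a + 1 < len i) (v : X) :
    (runPhase len rad O tie ω i (a + 1)).count v = (runPhase len rad O tie ω i a).count v +
      if played len rad O tie (phaseStart len i + a) ω = v then 1 else 0 := by
  simp only [State.count, rewards_runPhase_succ hlen ha]
  split_ifs <;> simp

lemma State.avg_of_count_eq_zero {st : State X} {v : X} (h : st.count v = 0) : st.avg v = 0 := by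
  simp [State.avg, h]

lemma total_runPhase (hlen : ∀ i, 0 < len i) {a : ℕ} (ha : a < len i) (v : X) :
    (runPhase len rad O tie ω i a).total v
      = (runPhase len rad O tie ω i 0).total v + (runPhase len rad O tie ω i a).count v := by
  classical
  induction a with
  | zero => rw [count_runPhase_zero hlen, add_zero]
  | succ a ih =>
    rw [count_runPhase_succ hlen ha, ← add_assoc, ← ih (by omega)]
    exact total_run_succ ω _ v

/-- The rewards of a strategy in a phase are its consecutive trials. -/
lemma sum_rewards_runPhase (hlen : ∀ i, 0 < len i) {a : ℕ} (ha : a < len i) (v : X) :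
    ((runPhase len rad O tie ω i a).rewards v).sum
      = ∑ j ∈ Finset.range ((runPhase len rad O tie ω i a).count v),
          ω (v, (runPhase len rad O tie ω i 0).total v + j) := by
  classical
  induction a with
  | zero => simp [count_runPhase_zero hlen, rewards_runPhase_zero hlen]
  | succ a ih =>
    rw [count_runPhase_succ hlen ha, rewards_runPhase_succ hlen ha]
    split_ifs with h
    · rw [List.sum_cons, ih (by omega), Finset.sum_range_succ, add_comm]
      congr 1
      rw [payoff_eq, h, ← total_runPhase hlen (by omega)]
      rfl
    · rw [ih (by omega), add_zero]

lemma sum_rewards_mem_Icc (hlen : ∀ i, 0 < len i)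
    (hpay : ∀ t, payoff len rad O tie t ω ∈ Set.Icc (0 : ℝ) 1) {a : ℕ} (ha : a < len i) (v : X) :
    ((runPhase len rad O tie ω i a).rewards v).sum
      ∈ Set.Icc (0 : ℝ) ((runPhase len rad O tie ω i a).count v) := by
  classical
  induction a with
  | zero => simp [count_runPhase_zero hlen, rewards_runPhase_zero hlen]
  | succ a ih =>
    have ih' := ih (by omega)
    rw [count_runPhase_succ hlen ha, rewards_runPhase_succ hlen ha]
    split_ifs with h
    · have h1 := hpay (phaseStart len i + a)
      rw [List.sum_cons]
      push_cast
      exact ⟨add_nonneg h1.1 ih'.1, by linarith [h1.2, ih'.2]⟩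
    · simpa using ih'

lemma avg_mem_Icc (hlen : ∀ i, 0 < len i)
    (hpay : ∀ t, payoff len rad O tie t ω ∈ Set.Icc (0 : ℝ) 1) {a : ℕ} (ha : a < len i) (v : X) :
    (runPhase len rad O tie ω i a).avg v ∈ Set.Icc (0 : ℝ) 1 := by
  have h := sum_rewards_mem_Icc hlen hpay ha v
  exact ⟨div_nonneg h.1 (Nat.cast_nonneg _), div_le_one_of_le₀ h.2 (Nat.cast_nonneg _)⟩

lemma avg_runPhase_succ (hlen : ∀ i, 0 < len i) {a : ℕ} (ha : a + 1 < len i) :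
    (runPhase len rad O tie ω i (a + 1)).avg (played len rad O tie (phaseStart len i + a) ω)
      * ((runPhase len rad O tie ω i a).count (played len rad O tie (phaseStart len i + a) ω) + 1
        : ℕ)
      = (runPhase len rad O tie ω i a).count (played len rad O tie (phaseStart len i + a) ω)
        * (runPhase len rad O tie ω i a).avg (played len rad O tie (phaseStart len i + a) ω)
        + payoff len rad O tie (phaseStart len i + a) ω := by
  classical
  set v := played len rad O tie (phaseStart len i + a) ω with hv
  simp only [State.avg]
  rw [count_runPhase_succ hlen ha, rewards_runPhase_succ hlen ha, if_pos hv.symm, if_pos hv.symm,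
    div_mul_cancel₀ _ (by positivity), List.sum_cons, add_comm]
  congr 1
  by_cases h0 : (runPhase len rad O tie ω i a).count v = 0
  · rw [h0]
    rw [State.count, List.length_eq_zero_iff] at h0
    simp [h0]
  · rw [mul_div_cancel₀ _ (by exact_mod_cast h0)]

/-! ### Activation and selection -/

/-- With no active strategy the oracle is asked about no balls, and these cannot cover a nonempty
`X`. -/
lemma activated_ne_nil [Nonempty X] {L : X → X → ℝ≥0∞} (hO : IsCoveringOracle L O)
    (st : State X) : st.activated rad O ≠ [] := by
  intro h
  rw [State.activated_eq, List.append_eq_nil_iff] at h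
  have hn : O [] = none := by
    have h2 := h.2
    rw [State.answer, h.1, List.map_nil] at h2
    simpa [Option.toList_eq_nil_iff] using h2
  obtain ⟨b, hb, _⟩ := (hO []).1 hn (Classical.arbitrary X)
  simp at hb

/-- The strategy that is played is active and has maximal index. -/
lemma play_mem_and_index_le [Nonempty X] {L : X → X → ℝ≥0∞} (hO : IsCoveringOracle L O)
    (htie : IsTieBreaking tie) (st : State X) :
    st.play rad O tie ∈ st.activated rad O ∧
      ∀ u ∈ st.activated rad O, st.index rad u ≤ st.index rad (st.play rad O tie) := by
  classical
  obtain ⟨v, hv, hmax⟩ := Set.exists_max_image {u | u ∈ st.activated rad O} (st.index rad)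
    (List.finite_toSet _) (List.exists_mem_of_ne_nil _ (activated_ne_nil (rad := rad) hO st))
  have h := htie ((st.activated rad O).filter fun v =>
    ∀ u ∈ st.activated rad O, st.index rad u ≤ st.index rad v) (by
      refine List.ne_nil_of_mem (a := v) (List.mem_filter.mpr ⟨hv, ?_⟩)
      simpa using hmax)
  have h2 := List.mem_filter.mp h
  have e : st.play rad O tie = tie ((st.activated rad O).filter fun v =>
      ∀ u ∈ st.activated rad O, st.index rad u ≤ st.index rad v) := by
    unfold State.play
    congr!
  rw [e]
  exact ⟨h2.1, of_decide_eq_true h2.2⟩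

lemma mem_active_of_count_ne_zero [Nonempty X] {L : X → X → ℝ≥0∞} (hO : IsCoveringOracle L O)
    (htie : IsTieBreaking tie) (hlen : ∀ i, 0 < len i) {a : ℕ} (ha : a < len i) {v : X}
    (hv : (runPhase len rad O tie ω i a).count v ≠ 0) :
    v ∈ (runPhase len rad O tie ω i a).active := by
  classical
  induction a with
  | zero => exact absurd (count_runPhase_zero hlen v) hv
  | succ a ih =>
    rw [count_runPhase_succ hlen ha] at hv
    rw [runPhase_succ hlen ha]
    by_cases h : played len rad O tie (phaseStart len i + a) ω = v
    · rw [← h]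
      exact (play_mem_and_index_le hO htie _).1
    · rw [if_neg h, add_zero] at hv
      rw [State.activated_eq]
      exact List.mem_append_left _ (ih (by omega) hv)

/-- An active strategy lies in its own ball, whose radius is positive. -/
lemma notMem_active_of_answer {L : X → X → ℝ≥0∞} (hL : IsQuasiDistance L)
    (hO : IsCoveringOracle L O) (hrad : ∀ i n m, 0 < rad i n m) {st : State X} {v : X}
    (hv : st.answer rad O = some v) : v ∉ st.active := by
  intro hmem
  refine (hO _).2 v hv (v, st.radius rad v) (List.mem_map.mpr ⟨v, hmem, rfl⟩) ?_
  simp only [hL.self_eq_zero]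
  exact ENNReal.ofReal_pos.mpr (hrad _ _ _)

/-- Every active strategy was returned by the oracle, before its first play in the phase. -/
lemma exists_answer_of_mem_active [Nonempty X] {L : X → X → ℝ≥0∞} (hL : IsQuasiDistance L)
    (hO : IsCoveringOracle L O) (htie : IsTieBreaking tie) (hlen : ∀ i, 0 < len i)
    (hrad : ∀ i n m, 0 < rad i n m) {a : ℕ} (ha : a < len i) {v : X}
    (hv : v ∈ (runPhase len rad O tie ω i a).active) :
    ∃ a₀ < a, (runPhase len rad O tie ω i a₀).answer rad O = some v ∧
      (runPhase len rad O tie ω i a₀).total v = (runPhase len rad O tie ω i 0).total v := by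
  induction a with
  | zero => simp [(runPhase_zero hlen).2.2] at hv
  | succ a ih =>
    rw [runPhase_succ hlen ha, State.activated_eq] at hv
    rcases List.mem_append.mp hv with h | h
    · obtain ⟨a₀, h1, h2⟩ := ih (by omega) h
      exact ⟨a₀, by omega, h2⟩
    · have hans : (runPhase len rad O tie ω i a).answer rad O = some v := by
        simpa [Option.mem_toList] using h
      refine ⟨a, Nat.lt_succ_self a, hans, ?_⟩
      rw [total_runPhase hlen (by omega)]
      by_contra hne
      exact notMem_active_of_answer hL hO hrad hans
        (mem_active_of_count_ne_zero hO htie hlen (by omega) fun h0 => hne (by rw [h0, add_zero]))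

open Classical in
lemma card_plays_eq_count (hlen : ∀ i, 0 < len i) {a : ℕ} (ha : a < len i)
    (v : X) : ((Finset.range a).filter fun b => played len rad O tie (phaseStart len i + b) ω = v
      ).card = (runPhase len rad O tie ω i a).count v := by
  induction a with
  | zero => simp [count_runPhase_zero hlen]
  | succ a ih =>
    rw [count_runPhase_succ hlen ha, ← ih (by omega), Finset.range_add_one, Finset.filter_insert]
    split_ifs
    · rw [Finset.card_insert_of_notMem (by simp)]
    · simp

lemma activated_subset (hlen : ∀ i, 0 < len i) {a b : ℕ} (hab : a ≤ b)
    (hb : b < len i) : (runPhase len rad O tie ω i a).activated rad O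
      ⊆ (runPhase len rad O tie ω i b).activated rad O := by
  induction b, hab using Nat.le_induction with
  | base => exact fun _ h => h
  | succ b hab ih =>
    intro v hv
    rw [State.activated_eq, runPhase_succ hlen hb]
    exact List.mem_append_left _ (ih (by omega) hv)

end

/-! ### A phase without large deviations -/

section

variable {X : Type*} {D : X → Measure ℝ}

lemma bddAbove_range_mean (hμ : ∀ x, mean D x ∈ Set.Icc (0 : ℝ) 1) :
    BddAbove (Set.range (mean D)) := ⟨1, by rintro _ ⟨x, rfl⟩; exact (hμ x).2⟩

lemma gap_nonneg (hμ : ∀ x, mean D x ∈ Set.Icc (0 : ℝ) 1) (x : X) : 0 ≤ gap D x :=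
  sub_nonneg.mpr (le_ciSup (bddAbove_range_mean hμ) x)

lemma gap_le_one (hμ : ∀ x, mean D x ∈ Set.Icc (0 : ℝ) 1) (x : X) : gap D x ≤ 1 := by
  have : Nonempty X := ⟨x⟩
  have h1 : bestMean D ≤ 1 := ciSup_le fun y => (hμ y).2
  have := (hμ x).1
  unfold gap
  linarith

variable [Nonempty X] {len : ℕ → ℕ} {O : List (X × ℝ) → Option X}
  {tie : List X → X} {ω : X × ℕ → ℝ} {i : ℕ} {L : X → X → ℝ≥0∞} {α : ℕ → ℝ} {T : ℕ}

/-- The family of grid radii with the scales `α i`. -/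
noncomputable def gridRadii (α : ℕ → ℝ) : ℕ → ℕ → ℝ → ℝ := fun i => gridRadius (α i)

/-- The assumptions on the problem and on the algorithm. -/
structure ZoomingSetting (L : X → X → ℝ≥0∞) (D : X → Measure ℝ) (len : ℕ → ℕ)
    (O : List (X × ℝ) → Option X) (tie : List X → X) (α : ℕ → ℝ) : Prop where
  quasi : IsQuasiDistance L
  oracle : IsCoveringOracle L O
  tie : IsTieBreaking tie
  len_pos : ∀ i, 0 < len i
  le_scale : ∀ i, 40 ≤ α i
  mean_mem : ∀ x, mean D x ∈ Set.Icc (0 : ℝ) 1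
  lip : RelaxedLipschitz L D

/-- All payoffs are in `[0, 1]`, and the averages in the first `T` rounds of phase `i` are within
the confidence radius. -/
structure CleanPhase (D : X → Measure ℝ) (len : ℕ → ℕ) (rad : ℕ → ℕ → ℝ → ℝ)
    (O : List (X × ℝ) → Option X) (tie : List X → X) (ω : X × ℕ → ℝ) (i T : ℕ) : Prop where
  payoff_mem : ∀ t, payoff len rad O tie t ω ∈ Set.Icc (0 : ℝ) 1
  le_len : T ≤ len i
  close : ∀ a < T, ∀ v, |(runPhase len rad O tie ω i a).avg v - mean D v|
    ≤ (runPhase len rad O tie ω i a).radius rad v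

/-- An unplayed strategy has radius at least `1`. If the played `w` has been played before, the
oracle found no uncovered point, and a nearly optimal `v` lies in the ball of some active `u`. Then
the index of `u` is at least `mean D u + r(u) ≥ μ* - ε`, whereas that of `w` is at most `mean D w +
3 r(w)`. -/
lemma gap_played_le (hs : ZoomingSetting L D len O tie α)
    (hc : CleanPhase D len (gridRadii α) O tie ω i T)
    {a : ℕ} (ha : a < T) :
    gap D (played len (gridRadii α) O tie (phaseStart len i + a) ω)
      ≤ 3 * (runPhase len (gridRadii α) O tie ω i a).radius
        (gridRadii α)
        (played len (gridRadii α) O tie (phaseStart len i + a) ω) := by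
  set rad : ℕ → ℕ → ℝ → ℝ := gridRadii α with hrad
  have hT := hc.le_len
  have hrad0 : ∀ i n m, 0 < rad i n m := fun i n m =>
    gridRadius_pos (by linarith [hs.le_scale i]) n m
  set st := runPhase len rad O tie ω i a with hst
  set w := played len rad O tie (phaseStart len i + a) ω with hw
  obtain ⟨-, hmax⟩ := play_mem_and_index_le (rad := rad) hs.oracle hs.tie st
  change ∀ u ∈ st.activated rad O, st.index rad u ≤ st.index rad w at hmax
  have hphase : st.phase = i := (runPhase_phase_age hs.len_pos (by omega)).1
  have havg := avg_mem_Icc hs.len_pos hc.payoff_mem (show a < len i by omega) w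
  have hgap := gap_le_one hs.mean_mem w
  by_cases h0 : st.count w = 0
  · have : 1 ≤ st.radius rad w := by
      rw [State.radius, h0]
      exact one_le_gridRadius_zero (hs.le_scale _) _
    linarith
  · have hnone : st.answer rad O = none := by
      by_contra hne
      obtain ⟨u, hu⟩ := Option.ne_none_iff_exists'.mp hne
      have hcu : st.count u = 0 := by
        by_contra hc
        exact notMem_active_of_answer hs.quasi hs.oracle hrad0 hu
          (mem_active_of_count_ne_zero hs.oracle hs.tie hs.len_pos (by omega) hc)
      have h1 := hmax u (by rw [State.activated_eq, hu]; simp)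
      have h2 := index_lt_index_fresh (hs.le_scale i) h0 havg.1 havg.2
      rw [State.index, State.index, State.radius, State.radius, State.avg_of_count_eq_zero hcu, hcu,
        hphase, zero_add] at h1
      exact absurd h1 (not_le.mpr h2)
    refine le_of_forall_pos_le_add fun ε hε => ?_
    obtain ⟨v, hv⟩ := hs.lip ε hε
    obtain ⟨b, hb, hcov⟩ := (hs.oracle _).1 hnone v
    obtain ⟨u, hu, rfl⟩ := List.mem_map.mp hb
    simp only at hcov
    have hru : 0 < st.radius rad u := hrad0 _ _ _
    have h1 : gap D u ≤ st.radius rad u + ε := by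
      have := (hv u).trans (add_le_add_left hcov.le _)
      rw [← ENNReal.ofReal_add hru.le hε.le] at this
      exact (ENNReal.ofReal_le_ofReal_iff (by positivity)).mp this
    have h2 := hmax u (by rw [State.activated_eq]; exact List.mem_append_left _ hu)
    have h3 := abs_le.mp (hc.close a ha u)
    have h4 := abs_le.mp (hc.close a ha w)
    rw [← hst] at h3 h4
    simp only [State.index] at h2
    unfold gap at h1 ⊢
    linarith [h3.1, h4.2]

/-- The radius of `v` changes only when `v` is played. Before such a play the constant is `3` by
`gap_played_le`, and a single play spoils it to at most `4`. Having this for strategies that are not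
currently played is what separates new strategies from old ones. -/
lemma gap_le_radius (hs : ZoomingSetting L D len O tie α)
    (hc : CleanPhase D len (gridRadii α) O tie ω i T)
    {a : ℕ} (ha : a < T) (v : X) :
    gap D v ≤ 4 * (runPhase len (gridRadii α) O tie ω i a).radius
        (gridRadii α) v := by
  classical
  set rad : ℕ → ℕ → ℝ → ℝ := gridRadii α with hrad
  have hT := hc.le_len
  induction a with
  | zero =>
    have : 1 ≤ (runPhase len rad O tie ω i 0).radius rad v := by
      rw [State.radius, count_runPhase_zero hs.len_pos]
      exact one_le_gridRadius_zero (hs.le_scale _) _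
    linarith [gap_le_one hs.mean_mem v]
  | succ a ih =>
    have hlt : a + 1 < len i := by omega
    have ih' := ih (by omega)
    have hp1 := (runPhase_phase_age (rad := rad) (O := O) (tie := tie) (ω := ω) hs.len_pos
      (show a < len i by omega)).1
    have hp2 := (runPhase_phase_age (rad := rad) (O := O) (tie := tie) (ω := ω) hs.len_pos hlt).1
    by_cases h : played len rad O tie (phaseStart len i + a) ω = v
    · have h1 := gap_played_le hs hc (show a < T by omega)
      have h2 := avg_runPhase_succ (rad := rad) (O := O) (tie := tie) (ω := ω) hs.len_pos hlt
      rw [← hrad, h] at h1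
      rw [h] at h2
      rw [State.radius, hp1] at h1
      rw [State.radius, hp2, count_runPhase_succ hs.len_pos hlt, if_pos h]
      exact gap_le_gridRadius_succ (hs.le_scale i)
        (avg_mem_Icc hs.len_pos hc.payoff_mem (by omega) v).2
        (hc.payoff_mem (phaseStart len i + a)).2 h2 (gap_le_one hs.mean_mem v) h1
    · have e : (runPhase len rad O tie ω i (a + 1)).radius rad v
          = (runPhase len rad O tie ω i a).radius rad v := by
        simp only [State.radius, State.avg, State.count, hp1, hp2,
          rewards_runPhase_succ hs.len_pos hlt,
          if_neg h]
      rw [e]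
      exact ih'

/-- Active strategies are far apart. -/
lemma pairwise_activated (hs : ZoomingSetting L D len O tie α)
    (hc : CleanPhase D len (gridRadii α) O tie ω i T)
    {a : ℕ} (ha : a < T) :
    ((runPhase len (gridRadii α) O tie ω i a).activated
      (gridRadii α) O).Pairwise
      fun u v => ENNReal.ofReal (min (gap D u) (gap D v) / 4) ≤ L u v := by
  set rad : ℕ → ℕ → ℝ → ℝ := gridRadii α with hrad
  have hT := hc.le_len
  have hstep : ∀ a < T, (runPhase len rad O tie ω i a).active.Pairwise
      (fun u v => ENNReal.ofReal (min (gap D u) (gap D v) / 4) ≤ L u v) →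
      ((runPhase len rad O tie ω i a).activated rad O).Pairwise
      (fun u v => ENNReal.ofReal (min (gap D u) (gap D v) / 4) ≤ L u v) := by
    intro a ha hact
    rw [State.activated_eq]
    cases hans : (runPhase len rad O tie ω i a).answer rad O with
    | none => simpa using hact
    | some w =>
      refine List.pairwise_append.mpr ⟨hact, by simp, fun u hu v hv => ?_⟩
      obtain rfl : v = w := by simpa using hv
      have h1 := (hs.oracle _).2 v hans (u, (runPhase len rad O tie ω i a).radius rad u)
        (List.mem_map.mpr ⟨u, hu, rfl⟩)
      refine le_trans (ENNReal.ofReal_le_ofReal ?_) (not_lt.mp h1)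
      have h2 := gap_le_radius hs hc ha u
      have := min_le_left (gap D u) (gap D v)
      simp only
      linarith
  refine hstep a ha ?_
  induction a with
  | zero => simp [(runPhase_zero hs.len_pos).2.2]
  | succ a ih =>
    rw [runPhase_succ hs.len_pos (by omega)]
    exact hstep a (by omega) (ih (by omega))

/-- A set of small diameter contains at most one of the played strategies that are bad at the same
scale. -/
lemma played_eq_of_mem (hs : ZoomingSetting L D len O tie α)
    (hc : CleanPhase D len (gridRadii α) O tie ω i T)
    {r : ℝ} (hr : 0 < r) {a b : ℕ} (ha : a < T) (hb : b < T)
    (hga : r / 2 < gap D (played len (gridRadii α) O tie (phaseStart len i + a) ω))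
    (hgb : r / 2 < gap D (played len (gridRadii α) O tie (phaseStart len i + b) ω))
    (hdist : L (played len (gridRadii α) O tie (phaseStart len i + a) ω)
      (played len (gridRadii α) O tie (phaseStart len i + b) ω)
        ≤ ENNReal.ofReal (r / 8)) :
    played len (gridRadii α) O tie (phaseStart len i + a) ω
      = played len (gridRadii α) O tie (phaseStart len i + b) ω := by
  set rad : ℕ → ℕ → ℝ → ℝ := gridRadii α with hrad
  have hT := hc.le_len
  by_contra hne
  have hp := pairwise_activated hs hc
    (show max a b < T by omega)
  have hma := activated_subset (O := O) (tie := tie) (ω := ω) (rad := rad) hs.len_pos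
    (le_max_left a b)
    (show max a b < len i by omega)
    (play_mem_and_index_le hs.oracle hs.tie (runPhase len rad O tie ω i a)).1
  have hmb := activated_subset (O := O) (tie := tie) (ω := ω) (rad := rad) hs.len_pos
    (le_max_right a b)
    (show max a b < len i by omega)
    (play_mem_and_index_le hs.oracle hs.tie (runPhase len rad O tie ω i b)).1
  -- The minimum in the separation bound makes the relation symmetric, so the order of activation is
  -- irrelevant.
  have hsymm : Std.Symm fun u v => ENNReal.ofReal (min (gap D u) (gap D v) / 4) ≤ L u v :=
    ⟨fun u v h => by rwa [min_comm, hs.quasi.symm]⟩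
  have h := hp.forall hma hmb hne
  have h1 := h.trans hdist
  rw [ENNReal.ofReal_le_ofReal_iff (by positivity)] at h1
  have := lt_min hga hgb
  change min (gap D (played len rad O tie (phaseStart len i + a) ω))
    (gap D (played len rad O tie (phaseStart len i + b) ω)) / 4 ≤ r / 8 at h1
  linarith

/-- The radius is still at least `gap / 3` when `v` is played, which limits the plays so far; the
summand `1` accounts for the present play. For `β = 1` the assumption `μ* = 1` makes `1 - gap` the
mean, so the clean-phase bound controls the observed loss. -/
lemma count_add_one_mul_rpow_le (hs : ZoomingSetting L D len O tie α)
    (hc : CleanPhase D len (gridRadii α) O tie ω i T)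
    {β : ℝ} (hβ : β = 2 ∨ β = 1 ∧ bestMean D = 1) {a : ℕ} (ha : a < T) {v : X}
    (hv : played len (gridRadii α) O tie (phaseStart len i + a) ω = v) :
    (1 + ((runPhase len (gridRadii α) O tie ω i a).count v : ℝ)) * gap D v ^ β
      ≤ 40 * α i := by
  have hT := hc.le_len
  have hα0 : 0 < α i := by linarith [hs.le_scale i]
  have h := gap_played_le hs hc ha
  have hv' := hc.close a ha v
  have havg := avg_mem_Icc hs.len_pos hc.payoff_mem (show a < len i by omega) v
  rw [hv] at h
  rw [State.radius, (runPhase_phase_age hs.len_pos (by omega)).1] at h hv'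
  simp only [gridRadii] at h hv' ⊢
  rcases hβ with rfl | ⟨rfl, h1⟩
  · rw [Real.rpow_two]
    exact mul_sq_le_of_le_gridRadius hα0 havg.1 (gap_nonneg hs.mean_mem v)
      (gap_le_one hs.mean_mem v) h
  · rw [Real.rpow_one]
    refine mul_le_of_le_gridRadius hα0 h ?_
    have h2 : 1 - gap D v = mean D v := by
      unfold gap
      rw [h1]
      ring
    rw [h2]
    have := (abs_le.mp hv').1
    linarith

end

/-! ### The total badness in a clean phase -/

/-- At scale `r = δ` the set to be covered is nonempty, so at least one set is needed. This supplies
a worst-case cost per round proportional to `C`, even for small `C`. -/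
lemma rpow_le_of_zoomingCover {X : Type*} {D : X → Measure ℝ} {L : X → X → ℝ≥0∞}
    {C d β δ : ℝ} (hZ : ZoomingCover L D C d) (hβ : 0 ≤ β)
    (hδ0 : 0 < δ) (hδ1 : δ ≤ 1) (hδ : IsLUB (Set.range (gap D)) δ) : δ ^ (d + β) ≤ C := by
  obtain ⟨N, F, hN, hF, -⟩ := hZ δ hδ0 hδ1
  obtain ⟨_, ⟨x, rfl⟩, hx, hx2⟩ := hδ.exists_between (half_lt_self hδ0)
  obtain ⟨j, -⟩ := hF x hx hx2
  have hN1 : (1 : ℝ) ≤ N := by exact_mod_cast (Fin.pos j)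
  have h1 : 1 ≤ C * δ ^ (-d) := hN1.trans hN
  rw [Real.rpow_neg hδ0.le, ← div_eq_mul_inv, one_le_div (by positivity)] at h1
  rw [Real.rpow_add hδ0]
  have : δ ^ β ≤ 1 := Real.rpow_le_one hδ0.le hδ1 hβ
  have h3 := Real.rpow_pos_of_pos hδ0 d
  nlinarith

lemma ZoomingCover.mono {X : Type*} {D : X → Measure ℝ} {L : X → X → ℝ≥0∞} {C d d' : ℝ} (hC : 0 ≤ C)
    (hZ : ZoomingCover L D C d) (hd : d ≤ d') :
    ZoomingCover L D C d' := by
  intro r hr hr1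
  obtain ⟨N, F, hN, h⟩ := hZ r hr hr1
  refine ⟨N, F, hN.trans ?_, h⟩
  gcongr C * ?_
  exact Real.rpow_le_rpow_of_exponent_ge hr hr1 (by linarith)

section

variable {X : Type*} {D : X → Measure ℝ} [Nonempty X] {len : ℕ → ℕ} {O : List (X × ℝ) → Option X}
  {tie : List X → X} {ω : X × ℕ → ℝ} {i : ℕ} {L : X → X → ℝ≥0∞} {α : ℕ → ℝ} {T : ℕ}

open Classical in
/-- The number of plays of strategies that are bad at scale `r`. -/
lemma card_scale_le (hs : ZoomingSetting L D len O tie α)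
    (hc : CleanPhase D len (gridRadii α) O tie ω i T)
    {β : ℝ} (hβ : β = 2 ∨ β = 1 ∧ bestMean D = 1) {r : ℝ} (hr : 0 < r) {N : ℕ} {F : Fin N → Set X}
    (hF : ∀ x, r / 2 < gap D x → gap D x ≤ r → ∃ j, x ∈ F j)
    (hdiam : ∀ j, ∀ x ∈ F j, ∀ y ∈ F j, L x y ≤ ENNReal.ofReal (r / 8)) :
    (((Finset.range T).filter fun a =>
      r / 2 < gap D (played len (gridRadii α) O tie (phaseStart len i + a) ω) ∧
        gap D (played len (gridRadii α) O tie (phaseStart len i + a) ω) ≤ r).card : ℝ)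
      ≤ N * (40 * α i * (r / 2) ^ (-β)) := by
  set x : ℕ → X := fun a => played len (gridRadii α) O tie (phaseStart len i + a) ω with hx
  set A := (Finset.range T).filter fun a => r / 2 < gap D (x a) ∧ gap D (x a) ≤ r with hA
  have hβ0 : 0 ≤ β := by rcases hβ with rfl | ⟨rfl, -⟩ <;> norm_num
  have hα0 : 0 < α i := by linarith [hs.le_scale i]
  have hsub : A ⊆ Finset.univ.biUnion fun j => A.filter fun a => x a ∈ F j := by
    intro a ha
    obtain ⟨j, hj⟩ := hF _ (Finset.mem_filter.mp ha).2.1 (Finset.mem_filter.mp ha).2.2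
    simp only [Finset.mem_biUnion, Finset.mem_univ, true_and, Finset.mem_filter]
    exact ⟨j, ha, hj⟩
  have hfib : ∀ j, ((A.filter fun a => x a ∈ F j).card : ℝ) ≤ 40 * α i * (r / 2) ^ (-β) := by
    intro j
    rcases (A.filter fun a => x a ∈ F j).eq_empty_or_nonempty with he | hne
    · rw [he, Finset.card_empty, Nat.cast_zero]
      positivity
    -- At the last such round `m`, all earlier plays in `F j` at this scale were plays of the same
    -- strategy, so its count at `m`, plus one, bounds them all.
    · set m := (A.filter fun a => x a ∈ F j).max' hne with hm
      have hmem := Finset.max'_mem _ hne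
      rw [← hm] at hmem
      simp only [hA, Finset.mem_filter, Finset.mem_range] at hmem
      have hsub2 : (A.filter fun a => x a ∈ F j)
          ⊆ insert m ((Finset.range m).filter fun b => x b = x m) := by
        intro b hb
        have hbm : b ≤ m := Finset.le_max' _ b hb
        simp only [hA, Finset.mem_filter, Finset.mem_range] at hb
        rcases hbm.eq_or_lt with rfl | hlt
        · exact Finset.mem_insert_self _ _
        · refine Finset.mem_insert_of_mem (Finset.mem_filter.mpr ⟨Finset.mem_range.mpr hlt, ?_⟩)
          exact played_eq_of_mem hs hc hr hb.1.1 hmem.1.1 hb.1.2.1 hmem.1.2.1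
            (hdiam j _ hb.2 _ hmem.2)
      have hcard := (Finset.card_le_card hsub2).trans (Finset.card_insert_le _ _)
      rw [card_plays_eq_count hs.len_pos (hmem.1.1.trans_le hc.le_len) (x m)] at hcard
      have hcard' : ((A.filter fun a => x a ∈ F j).card : ℝ)
          ≤ 1 + ((runPhase len (gridRadii α) O tie ω i m).count (x m) : ℝ) := by
        rw [add_comm]
        exact_mod_cast hcard
      have hb := count_add_one_mul_rpow_le hs hc hβ hmem.1.1 (v := x m) rfl
      refine hcard'.trans ?_
      rw [Real.rpow_neg (by positivity), ← div_eq_mul_inv, le_div_iff₀ (by positivity)]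
      refine le_trans ?_ hb
      gcongr
      exact hmem.1.2.1.le
  calc (A.card : ℝ) ≤ ∑ j, ((A.filter fun a => x a ∈ F j).card : ℝ) := by
        exact_mod_cast (Finset.card_le_card hsub).trans Finset.card_biUnion_le
    _ ≤ ∑ _j : Fin N, 40 * α i * (r / 2) ^ (-β) := Finset.sum_le_sum fun j _ => hfib j
    _ = _ := by simp

open Classical in
-- At most `C r ^ (-d) · 40 α (r / 2) ^ (-β)` rounds contribute at most `r ^ (d + β)` each; the
-- powers of `r` cancel, and `40 · 2 ^ β ≤ 160`.
lemma sum_scale_le (hs : ZoomingSetting L D len O tie α)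
    (hc : CleanPhase D len (gridRadii α) O tie ω i T)
    {β : ℝ} (hβ : β = 2 ∨ β = 1 ∧ bestMean D = 1) {C d : ℝ}
    (hZ : ZoomingCover L D C d) (hp : 1 ≤ d + β) {r : ℝ} (hr : 0 < r) (hr1 : r ≤ 1) :
    ∑ a ∈ (Finset.range T).filter (fun a =>
      r / 2 < gap D (played len (gridRadii α) O tie (phaseStart len i + a) ω) ∧
        gap D (played len (gridRadii α) O tie (phaseStart len i + a) ω) ≤ r),
      gap D (played len (gridRadii α) O tie (phaseStart len i + a) ω) ^ (d + β)
      ≤ 160 * α i * C := by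
  obtain ⟨N, F, hN, hF, hdiam⟩ := hZ r hr hr1
  have hcard := card_scale_le hs hc hβ hr hF hdiam
  have hα0 : 0 < α i := by linarith [hs.le_scale i]
  have hC : 0 ≤ C := by
    by_contra hneg
    push Not at hneg
    have := mul_neg_of_neg_of_pos hneg (Real.rpow_pos_of_pos hr (-d))
    linarith [(Nat.cast_nonneg N : (0 : ℝ) ≤ N)]
  have h2β : (2 : ℝ) ^ β ≤ 4 := by
    rcases hβ with rfl | ⟨rfl, -⟩ <;> norm_num
  calc _ ≤ ∑ a ∈ (Finset.range T).filter (fun a =>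
        r / 2 < gap D (played len (gridRadii α) O tie (phaseStart len i + a) ω) ∧
        gap D (played len (gridRadii α) O tie (phaseStart len i + a) ω) ≤ r), r ^ (d + β) := by
        refine Finset.sum_le_sum fun a ha => ?_
        exact Real.rpow_le_rpow (gap_nonneg hs.mean_mem _) (Finset.mem_filter.mp ha).2.2
          (by linarith)
    _ ≤ (N * (40 * α i * (r / 2) ^ (-β))) * r ^ (d + β) := by
        rw [Finset.sum_const, nsmul_eq_mul]
        gcongr
    _ ≤ (C * r ^ (-d) * (40 * α i * (r / 2) ^ (-β))) * r ^ (d + β) := by gcongr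
    _ = 40 * α i * C * 2 ^ β := by
        rw [Real.div_rpow hr.le (by norm_num), Real.rpow_neg (by norm_num : (0 : ℝ) ≤ 2),
          Real.rpow_neg hr.le, Real.rpow_neg hr.le, Real.rpow_add hr]
        have h1 := (Real.rpow_pos_of_pos hr d).ne'
        have h2 := (Real.rpow_pos_of_pos hr β).ne'
        field_simp
    _ ≤ 40 * α i * C * 4 := by gcongr
    _ = _ := by ring

lemma exists_scale {g δ : ℝ} (hg : g ≤ δ) {M : ℕ} (hM : δ / 2 ^ M < g) :
    ∃ k < M, δ / 2 ^ k / 2 < g ∧ g ≤ δ / 2 ^ k := by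
  induction M with
  | zero =>
    rw [pow_zero, div_one] at hM
    linarith
  | succ M ih =>
    by_cases h : δ / 2 ^ M < g
    · obtain ⟨k, hk, h2⟩ := ih h
      exact ⟨k, by omega, h2⟩
    · refine ⟨M, Nat.lt_succ_self M, ?_, not_lt.mp h⟩
      rwa [div_div, ← pow_succ]

/-- The `(d + β)`-moment of the badness in a clean phase. -/
lemma sum_gap_rpow_le (hs : ZoomingSetting L D len O tie α)
    (hc : CleanPhase D len (gridRadii α) O tie ω i T)
    {β : ℝ} (hβ : β = 2 ∨ β = 1 ∧ bestMean D = 1) {C d : ℝ}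
    (hZ : ZoomingCover L D C d) (hp : 1 ≤ d + β) {δ : ℝ} (hδ0 : 0 < δ) (hδ1 : δ ≤ 1)
    (hδ : ∀ x, gap D x ≤ δ) {M : ℕ} (hTM : T ≤ 2 ^ M) :
    ∑ a ∈ Finset.range T,
      gap D (played len (gridRadii α) O tie (phaseStart len i + a) ω) ^ (d + β)
      ≤ M * (160 * α i * C) + δ ^ (d + β) := by
  classical
  set p := d + β with hpdef
  set x : ℕ → X := fun a => played len (gridRadii α) O tie (phaseStart len i + a) ω with hx
  have hg0 : ∀ a, 0 ≤ gap D (x a) := fun a => gap_nonneg hs.mean_mem _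
  have hterm : ∀ a, gap D (x a) ^ p ≤ (∑ k ∈ Finset.range M,
      if δ / 2 ^ k / 2 < gap D (x a) ∧ gap D (x a) ≤ δ / 2 ^ k then gap D (x a) ^ p else 0)
      + (δ / 2 ^ M) ^ p := by
    intro a
    have hnn : ∀ k ∈ Finset.range M, 0 ≤
        if δ / 2 ^ k / 2 < gap D (x a) ∧ gap D (x a) ≤ δ / 2 ^ k then gap D (x a) ^ p else 0 := by
      intro k _
      have := Real.rpow_nonneg (hg0 a) p
      split_ifs <;> first | assumption | exact le_rfl
    by_cases h : δ / 2 ^ M < gap D (x a)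
    · obtain ⟨k, hk, h2⟩ := exists_scale (hδ (x a)) h
      have h3 := Finset.single_le_sum hnn (Finset.mem_range.mpr hk)
      rw [if_pos h2] at h3
      have : 0 ≤ (δ / 2 ^ M) ^ p := by positivity
      linarith
    · have := Real.rpow_le_rpow (hg0 a) (not_lt.mp h) (by linarith : 0 ≤ p)
      linarith [Finset.sum_nonneg hnn]
  have hscale : ∀ k ∈ Finset.range M, (∑ a ∈ Finset.range T,
      if δ / 2 ^ k / 2 < gap D (x a) ∧ gap D (x a) ≤ δ / 2 ^ k then gap D (x a) ^ p else 0)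
      ≤ 160 * α i * C := by
    intro k _
    rw [← Finset.sum_filter]
    exact sum_scale_le hs hc hβ hZ hp (by positivity)
      ((div_le_self hδ0.le (one_le_pow₀ (by norm_num))).trans hδ1)
  -- Rounds below the finest scale are treated crudely: `T ≤ 2 ^ M ≤ (2 ^ M) ^ p`, as `p ≥ 1`.
  have htail : (T : ℝ) * (δ / 2 ^ M) ^ p ≤ δ ^ p := by
    rw [Real.div_rpow hδ0.le (by positivity)]
    have h1 : (T : ℝ) ≤ 2 ^ M := by exact_mod_cast hTM
    have h2 : (2 : ℝ) ^ M ≤ (2 ^ M : ℝ) ^ p :=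
      Real.self_le_rpow_of_one_le (one_le_pow₀ (by norm_num)) hp
    rw [mul_div_assoc', div_le_iff₀ (by positivity), mul_comm]
    gcongr
    exact h1.trans h2
  calc _ ≤ ∑ a ∈ Finset.range T, ((∑ k ∈ Finset.range M,
        if δ / 2 ^ k / 2 < gap D (x a) ∧ gap D (x a) ≤ δ / 2 ^ k then gap D (x a) ^ p else 0)
        + (δ / 2 ^ M) ^ p) := Finset.sum_le_sum fun a _ => hterm a
    _ = (∑ k ∈ Finset.range M, ∑ a ∈ Finset.range T,
        if δ / 2 ^ k / 2 < gap D (x a) ∧ gap D (x a) ≤ δ / 2 ^ k then gap D (x a) ^ p else 0)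
        + T * (δ / 2 ^ M) ^ p := by
        rw [Finset.sum_add_distrib, Finset.sum_comm, Finset.sum_const, Finset.card_range,
          nsmul_eq_mul]
    _ ≤ (∑ _k ∈ Finset.range M, 160 * α i * C) + δ ^ p :=
        add_le_add (Finset.sum_le_sum hscale) htail
    _ = _ := by simp

end

/-! ### The probability of a large deviation in a phase -/

section

variable {X : Type*} {len : ℕ → ℕ} {rad : ℕ → ℕ → ℝ → ℝ} {O : List (X × ℝ) → Option X}
  {tie : List X → X} {D : X → Measure ℝ} {L : X → X → ℝ≥0∞} {α : ℕ → ℝ} {i : ℕ}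

/-- The event that the strategy activated at age `a` of phase `i` deviates after `n` plays. -/
def freshDeviation (D : X → Measure ℝ) (len : ℕ → ℕ) (rad : ℕ → ℕ → ℝ → ℝ)
    (O : List (X × ℝ) → Option X) (tie : List X → X) (A : ℝ) (i a n : ℕ) : Set (X × ℕ → ℝ) :=
  {ω | ∃ v, (runPhase len rad O tie ω i a).answer rad O = some v ∧
    ω ∈ deviation D A v ((runPhase len rad O tie ω i a).total v) n}

/-- The event that some strategy activated in phase `i` deviates in that phase. -/
def badEvent (D : X → Measure ℝ) (len : ℕ → ℕ) (rad : ℕ → ℕ → ℝ → ℝ)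
    (O : List (X × ℝ) → Option X) (tie : List X → X) (A : ℝ) (i : ℕ) : Set (X × ℕ → ℝ) :=
  ⋃ a ∈ Finset.range (len i), ⋃ n ∈ Finset.range (len i),
    freshDeviation D len rad O tie A i a (n + 1)

/-- The newly activated strategy with its number of trials so far. -/
noncomputable def freshTrial (len : ℕ → ℕ) (rad : ℕ → ℕ → ℝ → ℝ) (O : List (X × ℝ) → Option X)
    (tie : List X → X) (i a : ℕ) (ω : X × ℕ → ℝ) : Option (X × ℕ) :=
  ((runPhase len rad O tie ω i a).answer rad O).map fun v =>
    (v, (runPhase len rad O tie ω i a).total v)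

lemma discreteMeasurable_freshTrial (hrad : ∀ i n, DiscreteMeasurable (rad i n)) (a : ℕ) :
    DiscreteMeasurable (freshTrial len rad O tie i a) := by
  have h1 : DiscreteMeasurable fun ω => (runPhase len rad O tie ω i a).answer rad O :=
    discreteMeasurable_run hrad _ (g := fun st => st.answer rad O)
      (discreteMeasurable_oracle hrad)
  refine h1.bind (g := fun o ω => o.map fun v => (v, (runPhase len rad O tie ω i a).total v))
    fun o => ?_
  cases o with
  | none => exact DiscreteMeasurable.const none
  | some v =>
    exact (discreteMeasurable_total hrad (phaseStart len i + a) v).comp fun k => some (v, k)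

/-- The deviation event of a trial. -/
def trialDeviation (D : X → Measure ℝ) (A : ℝ) (n : ℕ) : Option (X × ℕ) → Set (X × ℕ → ℝ)
  | none => ∅
  | some p => deviation D A p.1 p.2 n

lemma freshDeviation_eq (A : ℝ) (a n : ℕ) : freshDeviation D len rad O tie A i a n
    = {ω | ω ∈ trialDeviation D A n (freshTrial len rad O tie i a ω)} := by
  ext ω
  simp only [freshDeviation, freshTrial, Set.mem_ofPred_eq]
  cases (runPhase len rad O tie ω i a).answer rad O with
  | none => simp [trialDeviation]
  | some v => simp [trialDeviation]

lemma measurableSet_trialDeviation (A : ℝ) (n : ℕ) (o : Option (X × ℕ)) :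
    MeasurableSet (trialDeviation D A n o) := by
  cases o with
  | none => exact MeasurableSet.empty
  | some p => exact measurableSet_deviation D A p.1 p.2 n

lemma measurableSet_badEvent (hrad : ∀ i n, DiscreteMeasurable (rad i n)) (A : ℝ) (i : ℕ) :
    MeasurableSet (badEvent D len rad O tie A i) := by
  refine Finset.measurableSet_biUnion _ fun a _ => Finset.measurableSet_biUnion _ fun n _ => ?_
  rw [freshDeviation_eq]
  exact (discreteMeasurable_freshTrial hrad a).measurableSet_bind (measurableSet_trialDeviation A _)

/-- The activated strategy `v` and its trial count `k` are determined without the trials of `v` from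
`k` on, and these trials alone decide the deviation. -/
lemma measure_freshDeviation_le [∀ x, IsProbabilityMeasure (D x)]
    (hrad : ∀ i n, DiscreteMeasurable (rad i n))
    (hD : ∀ x, ∀ᵐ y ∂(D x), y ∈ Set.Icc (0 : ℝ) 1) {b : ℝ} (hb : 0 < b) (a : ℕ) {n : ℕ}
    (hn : n ≠ 0) : rewardLaw D (freshDeviation D len rad O tie (16 * b) i a n)
      ≤ 2 * ENNReal.ofReal (Real.exp (-b)) := by
  rw [freshDeviation_eq]
  refine measure_adaptive_le (fun p : X × ℕ => D p.1) (discreteMeasurable_freshTrial hrad a)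
    (fun o => {p | ∃ q ∈ o, p.1 = q.1 ∧ q.2 ≤ p.2}) ?_ (measurableSet_trialDeviation _ n) ?_ ?_
  · rintro (_ | ⟨v, k⟩) ω ω' h hω
    · rwa [show ω' = ω from funext fun p => (h p (by simp)).symm]
    · obtain ⟨w, h1, h2⟩ := Option.map_eq_some_iff.mp hω
      obtain ⟨rfl, h3⟩ := Prod.mk.injEq .. ▸ h2
      have hr : run len rad O tie ω' (phaseStart len i + a)
          = run len rad O tie ω (phaseStart len i + a) :=
        run_congr_of_total_eq (fun p hp => h p (by simpa using hp)) h3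
      simpa only [freshTrial, runPhase, hr] using hω
  · rintro (_ | ⟨v, k⟩) ω ω' h
    · simp [trialDeviation]
    · have : ∀ j, ω (v, k + j) = ω' (v, k + j) := fun j => h _ ⟨(v, k), rfl, rfl, by simp⟩
      simp only [trialDeviation, deviation, this, Set.mem_ofPred_eq]
  · rintro (_ | ⟨v, k⟩)
    · simp [trialDeviation]
    · exact measure_deviation_le hD hb v k hn

lemma measure_badEvent_le [∀ x, IsProbabilityMeasure (D x)]
    (hrad : ∀ i n, DiscreteMeasurable (rad i n))
    (hD : ∀ x, ∀ᵐ y ∂(D x), y ∈ Set.Icc (0 : ℝ) 1) {b : ℝ} (hb : 0 < b) (i : ℕ) :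
    (rewardLaw D).real (badEvent D len rad O tie (16 * b) i)
      ≤ 2 * (len i : ℝ) ^ 2 * Real.exp (-b) := by
  have h : rewardLaw D (badEvent D len rad O tie (16 * b) i)
      ≤ ∑ _a ∈ Finset.range (len i), ∑ _n ∈ Finset.range (len i),
        2 * ENNReal.ofReal (Real.exp (-b)) := by
    refine (measure_biUnion_finset_le _ _).trans (Finset.sum_le_sum fun a _ => ?_)
    refine (measure_biUnion_finset_le _ _).trans (Finset.sum_le_sum fun n _ => ?_)
    exact measure_freshDeviation_le hrad hD hb a (Nat.succ_ne_zero n)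
  refine ENNReal.toReal_le_of_le_ofReal (by positivity) (h.trans_eq ?_)
  rw [ENNReal.ofReal_mul (by positivity), ENNReal.ofReal_mul (by norm_num),
    ENNReal.ofReal_pow (by positivity)]
  simp only [Finset.sum_const, Finset.card_range, nsmul_eq_mul, ENNReal.ofReal_natCast,
    ENNReal.ofReal_ofNat]
  ring

/-- A strategy not yet played in the phase cannot violate the bound, its radius being at least `1`.
A played one was activated earlier in the phase, before its first play there, so its rewards in the
phase are the consecutive trials following its activation. -/
lemma cleanPhase_of_notMem_badEvent [Nonempty X] (hs : ZoomingSetting L D len O tie α)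
    {ω : X × ℕ → ℝ} (hpay : ∀ t, payoff len (gridRadii α) O tie t ω ∈ Set.Icc (0 : ℝ) 1)
    (hω : ω ∉ badEvent D len (gridRadii α) O tie (α i) i) {T : ℕ} (hT : T ≤ len i) :
    CleanPhase D len (gridRadii α) O tie ω i T := by
  refine ⟨hpay, hT, fun a ha v => ?_⟩
  by_contra hdev
  push Not at hdev
  have hα0 : ∀ i, 0 < α i := fun i => by linarith [hs.le_scale i]
  have hai : a < len i := ha.trans_le hT
  set st := runPhase len (gridRadii α) O tie ω i a with hst
  have hphase : st.phase = i := (runPhase_phase_age hs.len_pos hai).1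
  have hcount : st.count v ≠ 0 := by
    intro h0
    rw [State.radius, State.avg_of_count_eq_zero h0, h0] at hdev
    have h1 : 1 ≤ gridRadii α st.phase 0 0 := one_le_gridRadius_zero (hs.le_scale _) _
    have h2 := hs.mean_mem v
    rw [zero_sub, abs_neg, abs_of_nonneg h2.1] at hdev
    linarith [h2.2]
  obtain ⟨a₀, ha₀, hans, htot⟩ := exists_answer_of_mem_active (rad := gridRadii α)
    hs.quasi hs.oracle hs.tie hs.len_pos
    (fun i n m => gridRadius_pos (hα0 i) n m) hai
    (mem_active_of_count_ne_zero hs.oracle hs.tie hs.len_pos hai hcount)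
  have hle : st.count v ≤ a := by
    classical
    rw [hst, ← card_plays_eq_count hs.len_pos hai]
    exact (Finset.card_filter_le _ _).trans (Finset.card_range a).le
  refine hω ?_
  simp only [badEvent, Set.mem_iUnion, Finset.mem_range, exists_prop]
  refine ⟨a₀, by omega, st.count v - 1, by omega, v, hans, ?_⟩
  rw [Nat.sub_add_cancel (Nat.one_le_iff_ne_zero.mpr hcount), htot]
  have havg : st.avg v = (∑ j ∈ Finset.range (st.count v),
      ω (v, (runPhase len (gridRadii α) O tie ω i 0).total v + j)) / st.count v := by
    rw [State.avg, hst, sum_rewards_runPhase hs.len_pos hai]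
  change refinedRadius _ _ _ < |_|
  rw [← havg]
  refine lt_of_le_of_lt ?_ hdev
  rw [State.radius, hphase]
  exact refinedRadius_le_gridRadius (hα0 i) _ _

/-! ### Expected badness in a phase -/

lemma discreteMeasurable_gridRadii (α : ℕ → ℝ) (i n : ℕ) :
    DiscreteMeasurable (gridRadii α i n) := by
  have h : Measurable fun m => ⌈100 * (1 + (n : ℝ)) / α i * refinedRadius (α i) n m⌉₊ :=
    ((measurable_refinedRadius (α i) n).const_mul _).nat_ceil
  exact (DiscreteMeasurable.of_measurable h).comp fun k : ℕ =>
    α i / (100 * (1 + (n : ℝ))) * (k : ℝ)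

lemma integrable_gap_rpow [∀ x, IsProbabilityMeasure (D x)]
    (hrad : ∀ i n, DiscreteMeasurable (rad i n)) (hμ : ∀ x, mean D x ∈ Set.Icc (0 : ℝ) 1)
    {p : ℝ} (hp : 0 ≤ p) (s : ℕ) :
    Integrable (fun ω => gap D (played len rad O tie s ω) ^ p) (rewardLaw D) := by
  refine integrable_of_mem_Icc
    ((discreteMeasurable_played hrad s).measurable_real fun x => gap D x ^ p) ?_
  exact Filter.Eventually.of_forall fun ω => ⟨Real.rpow_nonneg (gap_nonneg hμ _) _,
    Real.rpow_le_one (gap_nonneg hμ _) (gap_le_one hμ _) hp⟩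

/-- A clean phase costs at most `M · 160 α C + δ ^ p` with `δ = sup gap` and `δ ^ p ≤ C`. A bad
phase costs at most `T C` and has probability at most `1 / len i`, which adds one more `C`. -/
lemma sum_integral_gap_rpow_le [Nonempty X] [∀ x, IsProbabilityMeasure (D x)]
    (hs : ZoomingSetting L D len O tie α)
    (hD : ∀ x, ∀ᵐ y ∂(D x), y ∈ Set.Icc (0 : ℝ) 1)
    {β : ℝ} (hβ : β = 2 ∨ β = 1 ∧ bestMean D = 1) {C d : ℝ} (hC : 0 < C)
    (hZ : ZoomingCover L D C d) (hp : 1 ≤ d + β) {M : ℕ} (hM : len i = 2 ^ M)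
    (hbad : (rewardLaw D).real (badEvent D len (gridRadii α) O tie (α i) i) ≤ 1 / len i)
    {T : ℕ} (hT : T ≤ len i) :
    ∑ a ∈ Finset.range T, ∫ ω,
      gap D (played len (gridRadii α) O tie (phaseStart len i + a) ω) ^ (d + β) ∂(rewardLaw D)
      ≤ (M * (160 * α i) + 2) * C := by
  have hrad := discreteMeasurable_gridRadii α
  have hα0 : 0 < α i := by linarith [hs.le_scale i]
  have hβ0 : 0 ≤ β := by rcases hβ with rfl | ⟨rfl, -⟩ <;> norm_num
  set p := d + β with hpdef
  have hint := fun a => integrable_gap_rpow (O := O) (tie := tie) (len := len) hrad hs.mean_mem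
    (show 0 ≤ p by linarith) (phaseStart len i + a)
  set δ := ⨆ x, gap D x with hδdef
  have hbdd : BddAbove (Set.range (gap D)) :=
    ⟨1, by rintro _ ⟨x, rfl⟩; exact gap_le_one hs.mean_mem x⟩
  have hδ : IsLUB (Set.range (gap D)) δ := isLUB_ciSup hbdd
  have hδx : ∀ x, gap D x ≤ δ := le_ciSup hbdd
  have hδ1 : δ ≤ 1 := ciSup_le (gap_le_one hs.mean_mem)
  rcases (gap_nonneg hs.mean_mem (Classical.arbitrary X)).trans (hδx _) |>.eq_or_lt with h0 | hδ0
  · have hz : ∀ x, gap D x = 0 := fun x =>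
      le_antisymm ((hδx x).trans h0.symm.le) (gap_nonneg hs.mean_mem x)
    simp only [hz, Real.zero_rpow (show p ≠ 0 by linarith)]
    simp only [integral_zero, Finset.sum_const_zero]
    positivity
  · have hδC : δ ^ p ≤ C := rpow_le_of_zoomingCover hZ hβ0 hδ0 hδ1 hδ
    set bad := badEvent D len (gridRadii α) O tie (α i) i with hbaddef
    have hmbad : MeasurableSet bad := measurableSet_badEvent hrad _ _
    have hpt : ∀ᵐ ω ∂(rewardLaw D), ∑ a ∈ Finset.range T,
        gap D (played len (gridRadii α) O tie (phaseStart len i + a) ω) ^ p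
        ≤ (M * (160 * α i * C) + C) + bad.indicator (fun _ => T * C) ω := by
      refine (ae_payoff_mem_Icc (len := len) (O := O) (tie := tie) hrad hD).mono fun ω hpay => ?_
      by_cases hω : ω ∈ bad
      · rw [Set.indicator_of_mem hω]
        have : ∑ a ∈ Finset.range T,
            gap D (played len (gridRadii α) O tie (phaseStart len i + a) ω) ^ p
            ≤ ∑ _a ∈ Finset.range T, C := Finset.sum_le_sum fun a _ =>
          (Real.rpow_le_rpow (gap_nonneg hs.mean_mem _) (hδx _) (by linarith)).trans hδC
        rw [Finset.sum_const, Finset.card_range, nsmul_eq_mul] at this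
        have h2 : 0 ≤ M * (160 * α i * C) + C := by positivity
        linarith
      · rw [Set.indicator_of_notMem hω, add_zero]
        have := sum_gap_rpow_le hs (cleanPhase_of_notMem_badEvent hs hpay hω hT) hβ hZ hp hδ0 hδ1
          hδx (hT.trans hM.le)
        linarith
    have hint2 : Integrable (bad.indicator fun _ => (T : ℝ) * C) (rewardLaw D) :=
      (integrable_const _).indicator hmbad
    rw [← integral_finsetSum _ fun a _ => hint a]
    refine (integral_mono_ae (integrable_finsetSum _ fun a _ => hint a)
      ((integrable_const _).add hint2) hpt).trans ?_
    rw [integral_add' (integrable_const _) hint2, integral_indicator_const _ hmbad]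
    simp only [integral_const, probReal_univ, smul_eq_mul, one_mul]
    have hlen : (0 : ℝ) < len i := by exact_mod_cast hs.len_pos i
    have hT' : (T : ℝ) ≤ len i := by exact_mod_cast hT
    have h3 : (rewardLaw D).real bad * (T * C) ≤ 1 / len i * (len i * C) := by gcongr
    rw [one_div, inv_mul_cancel_left₀ hlen.ne'] at h3
    linarith

end

/-! ### Summation over the phases -/

/-- The phase lengths. -/
def phaseLen (i : ℕ) : ℕ := 2 ^ 2 ^ i

/-- The scales of the confidence radii. -/
noncomputable def phaseScale (i : ℕ) : ℝ := 64 * Real.log (phaseLen i)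

lemma two_le_phaseLen (i : ℕ) : 2 ≤ phaseLen i :=
  Nat.le_self_pow (pow_pos two_pos i).ne' 2

lemma phaseScale_eq (i : ℕ) : phaseScale i = 64 * (2 ^ i * Real.log 2) := by
  rw [phaseScale, phaseLen]
  push_cast
  rw [Real.log_pow]
  push_cast
  rfl

lemma le_phaseScale (i : ℕ) : 40 ≤ phaseScale i := by
  have h1 := Real.log_two_gt_d9
  have h2 : (1 : ℝ) ≤ 2 ^ i := one_le_pow₀ (by norm_num)
  rw [phaseScale_eq]
  nlinarith

/-- The scale `64 = 16 · 4` is chosen for this: a single deviation has probability at most `2 ℓ ^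
(-4)`, and at most `ℓ ^ 2` pairs of an age and a number of plays occur. -/
lemma two_mul_sq_mul_exp_le (i : ℕ) :
    2 * (phaseLen i : ℝ) ^ 2 * Real.exp (-(4 * Real.log (phaseLen i))) ≤ 1 / phaseLen i := by
  have h2 : (2 : ℝ) ≤ phaseLen i := by exact_mod_cast two_le_phaseLen i
  have h0 : (0 : ℝ) < phaseLen i := by linarith
  have : Real.exp (-(4 * Real.log (phaseLen i))) = 1 / (phaseLen i : ℝ) ^ 4 := by
    rw [Real.exp_neg, show (4 : ℝ) * Real.log (phaseLen i) = (4 : ℕ) * Real.log (phaseLen i) by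
      norm_num, Real.exp_nat_mul, Real.exp_log h0, one_div]
  rw [this, mul_one_div, div_le_div_iff₀ (by positivity) h0]
  have : 0 ≤ (phaseLen i : ℝ) ^ 3 * (phaseLen i - 2) := mul_nonneg (by positivity) (by linarith)
  linarith

/-- The bound is required for every initial segment of a phase, since `t` may fall inside one that
is much longer than `t`. -/
lemma sum_range_le_sum_phases {len : ℕ → ℕ} {h B : ℕ → ℝ} (hB0 : ∀ i, 0 ≤ B i)
    (hB : ∀ i, ∀ T ≤ len i, ∑ a ∈ Finset.range T, h (phaseStart len i + a) ≤ B i) {n t : ℕ}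
    (ht : t ≤ phaseStart len n) :
    ∑ s ∈ Finset.range t, h s ≤ ∑ i ∈ Finset.range n, B i := by
  induction n generalizing t with
  | zero =>
    obtain rfl : t = 0 := by simpa [phaseStart] using ht
    simp
  | succ n ih =>
    rw [Finset.sum_range_succ]
    by_cases hle : t ≤ phaseStart len n
    · linarith [ih hle, hB0 n]
    · obtain ⟨T, rfl⟩ := Nat.exists_eq_add_of_le (not_le.mp hle).le
      rw [Finset.sum_range_add]
      have hT : T ≤ len n := by
        rw [phaseStart, phaseStart, Finset.sum_range_succ] at ht
        omega
      exact add_le_add (ih le_rfl) (hB n T hT)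

/-- The round `t` belongs to a phase whose number is logarithmic in `log t`. -/
lemma exists_phase {t : ℕ} (ht : 2 ≤ t) :
    ∃ n, t ≤ phaseStart phaseLen (n + 1) ∧ (4 : ℝ) ^ n ≤ 9 * Real.log t ^ 2 := by
  have hex : ∃ n, t ≤ phaseStart phaseLen (n + 1) := by
    refine ⟨t, ?_⟩
    calc t ≤ ∑ _j ∈ Finset.range (t + 1), 1 := by simp
      _ ≤ _ := Finset.sum_le_sum fun j _ => (two_le_phaseLen j).trans' one_le_two
  classical
  refine ⟨Nat.find hex, Nat.find_spec hex, ?_⟩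
  have hl2 := Real.log_two_gt_d9
  cases hn : Nat.find hex with
  | zero =>
    have : Real.log 2 ≤ Real.log t := Real.log_le_log (by norm_num) (by exact_mod_cast ht)
    rw [pow_zero]
    nlinarith
  | succ m =>
    have hm := Nat.find_min hex (show m < Nat.find hex by omega)
    have hlen : phaseLen m ≤ t := by
      have : phaseLen m ≤ phaseStart phaseLen (m + 1) :=
        Finset.single_le_sum (f := phaseLen) (fun _ _ => Nat.zero_le _)
          (Finset.self_mem_range_succ m)
      omega
    have hlog : 2 ^ m * Real.log 2 ≤ Real.log t := by
      have h1 : Real.log (phaseLen m) ≤ Real.log t :=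
        Real.log_le_log (by exact_mod_cast (two_le_phaseLen m).trans_lt' two_pos)
          (by exact_mod_cast hlen)
      have h2 := phaseScale_eq m
      rw [phaseScale] at h2
      linarith
    have h3 : (2 ^ m * Real.log 2) ^ 2 ≤ Real.log t ^ 2 := by gcongr
    have h4 : (4 : ℝ) ^ (m + 1) = 4 * (2 ^ m) ^ 2 := by
      rw [← pow_mul, mul_comm m, pow_mul, pow_succ]
      norm_num
      ring
    rw [h4]
    rw [mul_pow] at h3
    have h5 : 0 ≤ ((2 : ℝ) ^ m) ^ 2 := by positivity
    -- This is where the constant `9` comes from: `4 / (log 2) ^ 2` is below it.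
    have h6 : (4 : ℝ) / 9 ≤ Real.log 2 ^ 2 := by nlinarith
    nlinarith

/-- The logarithm of the phase length doubles from phase to phase, so summing its squares costs only
a constant and no further logarithm. -/
lemma sum_four_pow_le (n : ℕ) : ∑ i ∈ Finset.range (n + 1), (4 : ℝ) ^ i ≤ 4 / 3 * 4 ^ n := by
  rw [geom_sum_eq (by norm_num), pow_succ]
  linarith

/-! ### From moments to the regret -/

/-- The tangent line inequality for `x ↦ x ^ p`. -/
lemma le_rpow_mul_rpow_add {g θ p : ℝ} (hg : 0 ≤ g) (hθ : 0 < θ) (hp : 1 ≤ p) :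
    g ≤ 1 / p * θ ^ (1 - p) * g ^ p + (1 - 1 / p) * θ := by
  have hp0 : 0 < p := by linarith
  have hw : 0 ≤ 1 - 1 / p := sub_nonneg.mpr ((div_le_one hp0).mpr hp)
  have h := Real.geom_mean_le_arith_mean2_weighted (w₁ := 1 / p) (w₂ := 1 - 1 / p)
    (p₁ := θ ^ (1 - p) * g ^ p) (p₂ := θ) (by positivity) hw (by positivity) hθ.le (by ring)
  refine le_trans (le_of_eq ?_) (h.trans_eq (by ring))
  rw [Real.mul_rpow (by positivity) (by positivity), ← Real.rpow_mul hg, ← Real.rpow_mul hθ.le,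
    mul_one_div_cancel hp0.ne', Real.rpow_one, mul_right_comm, ← Real.rpow_add hθ]
  have : (1 - p) * (1 / p) + (1 - 1 / p) = 0 := by
    field_simp
    ring
  rw [this, Real.rpow_zero, one_mul]

/-- Hölder's inequality over rounds and probability space together, in linearised form: the tangent
is taken at `θ = (Q / t) ^ (1 / p)`, the value at which a constant badness would have total moment
`Q`. -/
lemma sum_integral_le_rpow {Ω : Type*} [MeasurableSpace Ω] {P : Measure Ω}
    [IsProbabilityMeasure P] {g : ℕ → Ω → ℝ} (hg0 : ∀ s ω, 0 ≤ g s ω)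
    (hg : ∀ s, Integrable (g s) P) {p : ℝ} (hp : 1 ≤ p)
    (hgp : ∀ s, Integrable (fun ω => g s ω ^ p) P) {t : ℕ} (ht : 0 < t) {Q : ℝ} (hQ : 0 < Q)
    (h : ∑ s ∈ Finset.range t, ∫ ω, g s ω ^ p ∂P ≤ Q) :
    ∑ s ∈ Finset.range t, ∫ ω, g s ω ∂P ≤ Q ^ (1 / p) * (t : ℝ) ^ (1 - 1 / p) := by
  have hp0 : 0 < p := by linarith
  have ht0 : (0 : ℝ) < t := by exact_mod_cast ht
  set θ := (Q / t) ^ (1 / p) with hθ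
  have hθ0 : 0 < θ := by positivity
  have hθp : θ ^ p = Q / t := by
    rw [hθ, ← Real.rpow_mul (by positivity), one_div_mul_cancel hp0.ne', Real.rpow_one]
  have h1 : ∀ s, ∫ ω, g s ω ∂P
      ≤ 1 / p * θ ^ (1 - p) * ∫ ω, g s ω ^ p ∂P + (1 - 1 / p) * θ := by
    intro s
    have hi := (hgp s).const_mul (1 / p * θ ^ (1 - p))
    refine (integral_mono (hg s) (hi.add (integrable_const ((1 - 1 / p) * θ)))
      fun ω => le_rpow_mul_rpow_add (hg0 s ω) hθ0 hp).trans_eq ?_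
    rw [integral_add' hi (integrable_const _), integral_const_mul]
    simp
  calc _ ≤ ∑ s ∈ Finset.range t,
        (1 / p * θ ^ (1 - p) * ∫ ω, g s ω ^ p ∂P + (1 - 1 / p) * θ) :=
        Finset.sum_le_sum fun s _ => h1 s
    _ = 1 / p * θ ^ (1 - p) * (∑ s ∈ Finset.range t, ∫ ω, g s ω ^ p ∂P)
        + t * ((1 - 1 / p) * θ) := by
        rw [Finset.sum_add_distrib, ← Finset.mul_sum, Finset.sum_const, Finset.card_range,
          nsmul_eq_mul]
    _ ≤ 1 / p * θ ^ (1 - p) * Q + t * ((1 - 1 / p) * θ) := by gcongr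
    _ = θ * t := by
        have : Q = θ ^ p * t := by rw [hθp]; field_simp
        rw [this, Real.rpow_sub hθ0, Real.rpow_one]
        have := (Real.rpow_pos_of_pos hθ0 p).ne'
        field_simp
        ring
    _ = _ := by
        rw [hθ, Real.div_rpow hQ.le ht0.le, Real.rpow_sub ht0, Real.rpow_one]
        ring

section

variable {X : Type*} {O : List (X × ℝ) → Option X} {tie : List X → X}
  {D : X → Measure ℝ} [∀ x, IsProbabilityMeasure (D x)] {L : X → X → ℝ≥0∞}

lemma regret_eq_sum {len : ℕ → ℕ} {rad : ℕ → ℕ → ℝ → ℝ}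
    (hrad : ∀ i n, DiscreteMeasurable (rad i n))
    (hD : ∀ x, ∀ᵐ y ∂(D x), y ∈ Set.Icc (0 : ℝ) 1) (t : ℕ) :
    regret D len rad O tie t
      = ∑ s ∈ Finset.range t, ∫ ω, gap D (played len rad O tie s ω) ∂(rewardLaw D) := by
  have hpay : ∀ s, Integrable (payoff len rad O tie s) (rewardLaw D) := fun s =>
    integrable_of_mem_Icc (measurable_payoff hrad s)
      ((ae_payoff_mem_Icc hrad hD).mono fun ω h => h s)
  have hmean : ∀ s, Integrable (fun ω => mean D (played len rad O tie s ω)) (rewardLaw D) :=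
    fun s => integrable_of_mem_Icc
      ((discreteMeasurable_played hrad s).measurable_real (mean D))
      (Filter.Eventually.of_forall fun ω => mean_mem_Icc (hD _))
  rw [regret, integral_finsetSum _ fun s _ => hpay s]
  have : ∀ s, ∫ ω, gap D (played len rad O tie s ω) ∂(rewardLaw D)
      = bestMean D - ∫ ω, payoff len rad O tie s ω ∂(rewardLaw D) := by
    intro s
    rw [integral_payoff hrad hD]
    simp only [gap]
    rw [integral_sub (integrable_const _) (hmean s)]
    simp
  simp only [this, Finset.sum_sub_distrib]
  simp

/-- The regret bound for exponents at least one. -/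
lemma regret_le [Nonempty X] (hs : ZoomingSetting L D phaseLen O tie phaseScale)
    (hD : ∀ x, ∀ᵐ y ∂(D x), y ∈ Set.Icc (0 : ℝ) 1)
    {β : ℝ} (hβ : β = 2 ∨ β = 1 ∧ bestMean D = 1) {C d : ℝ} (hC : 0 < C)
    (hZ : ZoomingCover L D C d) (hp : 1 ≤ d + β) {t : ℕ} (ht : 2 ≤ t) :
    regret D phaseLen (gridRadii phaseScale) O tie t
      ≤ (130000 * C * Real.log t ^ 2) ^ (1 / (d + β)) * (t : ℝ) ^ (1 - 1 / (d + β)) := by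
  have hrad := discreteMeasurable_gridRadii phaseScale
  have hlog : 0 < Real.log t := Real.log_pos (by exact_mod_cast ht)
  have hint : ∀ {q : ℝ}, 0 ≤ q → ∀ s, Integrable (fun ω =>
      gap D (played phaseLen (gridRadii phaseScale) O tie s ω) ^ q) (rewardLaw D) :=
    fun hq s => integrable_gap_rpow hrad hs.mean_mem hq s
  rw [regret_eq_sum hrad hD]
  refine sum_integral_le_rpow (fun s ω => gap_nonneg hs.mean_mem _)
    (fun s => by simpa using hint zero_le_one s) hp (hint (by linarith)) (by omega)
    (by positivity) ?_
  obtain ⟨n, hn, h4n⟩ := exists_phase ht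
  have hphase : ∀ i, ∀ T ≤ phaseLen i, ∑ a ∈ Finset.range T, ∫ ω,
      gap D (played phaseLen (gridRadii phaseScale) O tie (phaseStart phaseLen i + a) ω) ^ (d + β)
        ∂(rewardLaw D) ≤ 10242 * C * 4 ^ i := by
    intro i T hT
    have hbad : (rewardLaw D).real (badEvent D phaseLen (gridRadii phaseScale) O tie
        (phaseScale i) i) ≤ 1 / phaseLen i := by
      have hpos : 0 < 4 * Real.log (phaseLen i) :=
        mul_pos (by norm_num) (Real.log_pos (by exact_mod_cast two_le_phaseLen i))
      have := measure_badEvent_le (len := phaseLen) (O := O) (tie := tie) hrad hD hpos i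
      rw [show 16 * (4 * Real.log (phaseLen i)) = phaseScale i by rw [phaseScale]; ring] at this
      exact this.trans (two_mul_sq_mul_exp_le i)
    refine (sum_integral_gap_rpow_le hs hD hβ hC hZ hp (M := 2 ^ i) rfl hbad hT).trans ?_
    have hα : phaseScale i ≤ 64 * 2 ^ i := by
      rw [phaseScale_eq]
      have := Real.log_two_lt_d9
      have h2 : (0 : ℝ) < 2 ^ i := by positivity
      nlinarith
    have h4 : (4 : ℝ) ^ i = 2 ^ i * 2 ^ i := by rw [← mul_pow]; norm_num
    have h1 : (1 : ℝ) ≤ 4 ^ i := one_le_pow₀ (by norm_num)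
    -- Here `10242 = 160 · 64 + 2`.
    have h5 : ((2 ^ i : ℕ) : ℝ) * (160 * phaseScale i) + 2 ≤ 10242 * 4 ^ i := by
      push_cast
      have : (2 : ℝ) ^ i * (160 * phaseScale i) ≤ 2 ^ i * (160 * (64 * 2 ^ i)) := by gcongr
      linarith
    calc _ ≤ 10242 * 4 ^ i * C := by gcongr
      _ = _ := by ring
  refine (sum_range_le_sum_phases (len := phaseLen) (h := fun s => ∫ ω,
    gap D (played phaseLen (gridRadii phaseScale) O tie s ω) ^ (d + β) ∂(rewardLaw D))
    (fun i => by positivity) hphase hn).trans ?_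
  rw [← Finset.mul_sum]
  -- The constants multiply to `10242 · 12 = 122904`, which is rounded up to `130000`.
  calc 10242 * C * ∑ i ∈ Finset.range (n + 1), (4 : ℝ) ^ i
      ≤ 10242 * C * (4 / 3 * (9 * Real.log t ^ 2)) := by
        gcongr
        exact (sum_four_pow_le n).trans (by gcongr)
    _ ≤ 130000 * C * Real.log t ^ 2 := by
        have : 0 ≤ C * Real.log t ^ 2 := by positivity
        linarith

lemma goodRegret [Nonempty X] (hs : ZoomingSetting L D phaseLen O tie phaseScale)
    (hD : ∀ x, ∀ᵐ y ∂(D x), y ∈ Set.Icc (0 : ℝ) 1)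
    {β : ℝ} (hβ : β = 2 ∨ β = 1 ∧ bestMean D = 1) :
    GoodRegret 130000 β L D (regret D phaseLen (gridRadii phaseScale) O tie) := by
  intro C d hC hZ t ht
  refine ⟨fun hp => regret_le hs hD hβ hC hZ hp.le ht, fun hp => ?_⟩
  -- With `d` raised to `1 - β` the exponent is exactly `1`, and the power of `t` disappears.
  have h := regret_le hs hD hβ hC (hZ.mono hC.le (show d ≤ 1 - β by linarith))
    (by linarith) ht
  simpa using h

end

end ZoomingBandit

theorem mainTheorem10 :
    ∃ (len : ℕ → ℕ) (rad : ℕ → ℕ → ℝ → ℝ) (κ K : ℝ), 0 < κ ∧ 0 < K ∧ (∀ i, 2 ≤ len i) ∧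
      (∀ (i n : ℕ) (m : ℝ), 0 ≤ m → m ≤ 1 →
        ZoomingBandit.refinedRadius (κ * Real.log (len i)) n m ≤ rad i n m ∧
        rad i n m ≤ 2 * ZoomingBandit.refinedRadius (κ * Real.log (len i)) n m) ∧
      ∀ (X : Type*) [Nonempty X] (L : X → X → ENNReal), ZoomingBandit.IsQuasiDistance L →
      ∀ O : List (X × ℝ) → Option X, ZoomingBandit.IsCoveringOracle L O →
      ∀ tie : List X → X, ZoomingBandit.IsTieBreaking tie →
        ZoomingBandit.WellPosed len rad O tie ∧
        ∀ (D : X → MeasureTheory.Measure ℝ) [∀ x, MeasureTheory.IsProbabilityMeasure (D x)],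
          (∀ x, ∀ᵐ y ∂(D x), y ∈ Set.Icc (0 : ℝ) 1) →
          ZoomingBandit.RelaxedLipschitz L D →
          ZoomingBandit.GoodRegret K 2 L D (ZoomingBandit.regret D len rad O tie) ∧
          (ZoomingBandit.bestMean D = 1 →
            ZoomingBandit.GoodRegret K 1 L D (ZoomingBandit.regret D len rad O tie)) := by
  refine ⟨ZoomingBandit.phaseLen, ZoomingBandit.gridRadii ZoomingBandit.phaseScale, 64, 130000,
    by norm_num, by norm_num, ZoomingBandit.two_le_phaseLen, fun i n m _ _ => ?_, ?_⟩
  · have hα : 0 < ZoomingBandit.phaseScale i := by linarith [ZoomingBandit.le_phaseScale i]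
    have h1 := ZoomingBandit.refinedRadius_pos hα n m
    refine ⟨ZoomingBandit.refinedRadius_le_gridRadius hα n m, ?_⟩
    refine (ZoomingBandit.gridRadius_le hα n m).trans ?_
    change _ ≤ 2 * ZoomingBandit.refinedRadius (ZoomingBandit.phaseScale i) n m
    linarith
  · intro X _ L hL O hO tie htie
    refine ⟨ZoomingBandit.wellPosed (ZoomingBandit.discreteMeasurable_gridRadii _),
      fun D _ hD hlip => ?_⟩
    have hs : ZoomingBandit.ZoomingSetting L D ZoomingBandit.phaseLen O tie
        ZoomingBandit.phaseScale :=
      ⟨hL, hO, htie, fun i => (ZoomingBandit.two_le_phaseLen i).trans' (by norm_num),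
        ZoomingBandit.le_phaseScale, fun x => ZoomingBandit.mean_mem_Icc (hD x), hlip⟩
    exact ⟨ZoomingBandit.goodRegret hs hD (Or.inl rfl),
      fun h1 => ZoomingBandit.goodRegret hs hD (Or.inr ⟨rfl, h1⟩)⟩
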